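/- Let $t,s_2,s_3,r_2\in\mathbb{C}$ with $t\ne 0,1$, put $s_1=r_1=1$, and assume $r_1+r_2=s_1+s_2+s_3-1$ (that is, $r_2=s_2+s_3-1$). For $\lambda\in\mathbb{C}$ let $$D_x=x(x-1)(x-t)\frac{d^2}{dx^2}+x(x-1)(x-t)\Big(\frac{s_1}{x}+\frac{s_2}{x-1}+\frac{s_3}{x-t}\Big)\frac{d}{dx}+r_1r_2x+\lambda ,$$ and let $f_\lambda(x)=\sum_{i\ge 0}P_i(\lambda)x^i$ be the unique power series solution (it converges near $x=0$) of $D_xf_\lambda=0$ with $f_\lambda(0)=1$. Here $P_i\in\mathbb{C}[\lambda]$ has degree $i$, so the $P_i$ form a basis of $\mathbb{C}[\lambda]$. Define the structure constants $C_{i,j}^k\in\mathbb{C}$ by $P_iP_j=\sum_kC_{i,j}^kP_k$, and define the kernel $$K(x_1,x_2,y)=\sum_{i,j,k\ge 0}C_{i,j}^k\,\frac{x_1^ix_2^j}{y^{k+1}} .$$ Then there is $\varepsilon>0$ such that for all $x_1,x_2,y\in\mathbb{C}$ with $|x_1|<\varepsilon$, $|x_2|<\varepsilon$, $|y|>1/\varepsilon$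 this series converges absolutely and $$K(x_1,x_2,y)=\Bigg(\frac{2t-t(x_1+x_2+y)+x_1x_2y+tyP^{1/2}}{2t(1-x_1)(1-x_2)}\Bigg)^{s_2-1}\Bigg(\frac{2t^2-t(x_1+x_2+y)+x_1x_2y+tyP^{1/2}}{2(t-x_1)(t-x_2)}\Bigg)^{s_3-1}\frac{1}{yP^{1/2}},$$ where $$P=1-\frac{2x_1}{y}-\frac{2x_2}{y}+\frac{x_1^2}{y^2}+\frac{x_2^2}{y^2}-\frac{2x_1^2x_2}{ty}-\frac{2x_1x_2^2}{ty}+\frac{x_1^2x_2^2}{t^2}+\frac{2(2ty-y^2-t+2y)x_1x_2}{ty^2}$$ and all powers are principal values. (As $x_1,x_2\to0$ and $y\to\infty$, $P$ and the two bases tend to $1$.) -/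

import Mathlib

open Polynomial

noncomputable section

/-- The Heun operator
`D = x(x-1)(x-t) d²/dx² + x(x-1)(x-t) (s₁/x + s₂/(x-1) + s₃/(x-t)) d/dx + r₁ r₂ x + l`
acting on formal power series in `x`. The accessory parameter `l` lives in a commutative
`ℂ`-algebra `A`: for `A = ℂ` it is a complex number, for `A = ℂ[X]` it can be the variable. -/
def heunOp {A : Type*} [CommRing A] [Algebra ℂ A] (t s₁ s₂ s₃ r₁ r₂ : ℂ) (l : A)
    (f : PowerSeries A) : PowerSeries A :=
  let x : PowerSeries A := PowerSeries.X
  let c : ℂ → PowerSeries A := fun z => PowerSeries.C (algebraMap ℂ A z)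
  let d : PowerSeries A → PowerSeries A := fun g => PowerSeries.derivative A g
  x * (x - 1) * (x - c t) * d (d f)
    + (c s₁ * ((x - 1) * (x - c t)) + c s₂ * (x * (x - c t)) + c s₃ * (x * (x - 1))) * d f
    + (c (r₁ * r₂) * x + PowerSeries.C l) * f

/-- The coefficients `P_i(l) ∈ ℂ[l]` of the power series solution
`f_l(x) = ∑ P_i(l) x^i`, `f_l(0) = 1`, of the Heun equation `D f_l = 0`
(see `heunOp_eq_zero_iff`). -/
def heunPoly (t s₁ s₂ s₃ r₁ r₂ : ℂ) : ℕ → ℂ[X]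
  | 0 => 1
  | 1 => -(C (t * s₁)⁻¹ * X)
  | (n + 2) =>
      C (t * (n + 2) * (n + 1 + s₁))⁻¹ *
        ((C ((n + 1) * ((1 + t) * (n + s₁) + s₂ * t + s₃)) - X)
            * heunPoly t s₁ s₂ s₃ r₁ r₂ (n + 1)
          - C ((n + r₁) * (n + r₂)) * heunPoly t s₁ s₂ s₃ r₁ r₂ n)

theorem heunOp_eq {A : Type*} [CommRing A] [Algebra ℂ A] (t s₁ s₂ s₃ r₁ r₂ : ℂ) (l : A)
    (f : PowerSeries A) :
    heunOp t s₁ s₂ s₃ r₁ r₂ l f =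
      PowerSeries.X ^ 3 * PowerSeries.derivative A (PowerSeries.derivative A f)
      - PowerSeries.C (algebraMap ℂ A (1 + t)) *
        (PowerSeries.X ^ 2 * PowerSeries.derivative A (PowerSeries.derivative A f))
      + PowerSeries.C (algebraMap ℂ A t) *
        (PowerSeries.X ^ 1 * PowerSeries.derivative A (PowerSeries.derivative A f))
      + PowerSeries.C (algebraMap ℂ A (s₁ + s₂ + s₃)) *
        (PowerSeries.X ^ 2 * PowerSeries.derivative A f)
      - PowerSeries.C (algebraMap ℂ A (s₁ * (1 + t) + s₂ * t + s₃)) *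
        (PowerSeries.X ^ 1 * PowerSeries.derivative A f)
      + PowerSeries.C (algebraMap ℂ A (s₁ * t)) * PowerSeries.derivative A f
      + PowerSeries.C (algebraMap ℂ A (r₁ * r₂)) * (PowerSeries.X ^ 1 * f)
      + PowerSeries.C l * f := by
  simp only [heunOp, map_add, map_mul, map_one]
  ring

theorem coeff_zero_heunOp {A : Type*} [CommRing A] [Algebra ℂ A] (t s₁ s₂ s₃ r₁ r₂ : ℂ) (l : A)
    (f : PowerSeries A) :
    PowerSeries.coeff 0 (heunOp t s₁ s₂ s₃ r₁ r₂ l f) =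
      algebraMap ℂ A (t * s₁) * PowerSeries.coeff 1 f + l * PowerSeries.coeff 0 f := by
  rw [heunOp_eq]
  simp only [LinearMap.map_add, LinearMap.map_sub, PowerSeries.coeff_C_mul,
    PowerSeries.coeff_X_pow_mul', PowerSeries.coeff_derivative]
  simp [-PowerSeries.coeff_zero_eq_constantCoeff]
  ring

theorem coeff_succ_heunOp {A : Type*} [CommRing A] [Algebra ℂ A] (t s₁ s₂ s₃ r₁ r₂ : ℂ)
    (hr : r₁ + r₂ = s₁ + s₂ + s₃ - 1) (l : A) (f : PowerSeries A) (n : ℕ) :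
    PowerSeries.coeff (n + 1) (heunOp t s₁ s₂ s₃ r₁ r₂ l f) =
      algebraMap ℂ A (t * (n + 2) * (n + 1 + s₁)) * PowerSeries.coeff (n + 2) f
        - (algebraMap ℂ A ((n + 1) * ((1 + t) * (n + s₁) + s₂ * t + s₃)) - l)
            * PowerSeries.coeff (n + 1) f
        + algebraMap ℂ A ((n + r₁) * (n + r₂)) * PowerSeries.coeff n f := by
  have hr2 : algebraMap ℂ A r₁ + algebraMap ℂ A r₂ =
      algebraMap ℂ A s₁ + algebraMap ℂ A s₂ + algebraMap ℂ A s₃ - 1 := by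
    simpa using congrArg (algebraMap ℂ A) hr
  have h2 : algebraMap ℂ A 2 = 2 := map_ofNat _ 2
  have hd (m : ℕ) : PowerSeries.coeff m (PowerSeries.derivative A f) =
      PowerSeries.coeff (m + 1) f * (m + 1) := PowerSeries.coeff_derivative f m
  have hdd (m : ℕ) : PowerSeries.coeff m (PowerSeries.derivative A (PowerSeries.derivative A f)) =
      PowerSeries.coeff (m + 2) f * (m + 2) * (m + 1) := by
    rw [PowerSeries.coeff_derivative, hd]
    push_cast
    ring
  have e1 (g : PowerSeries A) (m : ℕ) :
      PowerSeries.coeff (m + 1) (PowerSeries.X ^ 1 * g) = PowerSeries.coeff m g := by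
    simp
  have e2 (g : PowerSeries A) (m : ℕ) :
      PowerSeries.coeff (m + 2) (PowerSeries.X ^ 2 * g) = PowerSeries.coeff m g :=
    PowerSeries.coeff_X_pow_mul g 2 m
  have e3 (g : PowerSeries A) (m : ℕ) :
      PowerSeries.coeff (m + 3) (PowerSeries.X ^ 3 * g) = PowerSeries.coeff m g :=
    PowerSeries.coeff_X_pow_mul g 3 m
  have z2 (g : PowerSeries A) : PowerSeries.coeff 1 (PowerSeries.X ^ 2 * g) = 0 := by
    simp [PowerSeries.coeff_X_pow_mul']
  have z3 (g : PowerSeries A) : PowerSeries.coeff 1 (PowerSeries.X ^ 3 * g) = 0 := by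
    simp [PowerSeries.coeff_X_pow_mul']
  have z3' (g : PowerSeries A) : PowerSeries.coeff 2 (PowerSeries.X ^ 3 * g) = 0 := by
    simp [PowerSeries.coeff_X_pow_mul']
  rw [heunOp_eq]
  rcases n with _ | _ | n
  · simp only [LinearMap.map_add, LinearMap.map_sub, PowerSeries.coeff_C_mul, e1, z2, z3, hd, hdd,
      zero_add]
    simp only [map_add, map_mul, map_zero, map_one, h2, Nat.cast_zero]
    ring
  · simp only [LinearMap.map_add, LinearMap.map_sub, PowerSeries.coeff_C_mul, e1, e2 _ 0, z3', hd,
      hdd, zero_add, Nat.reduceAdd]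
    simp only [map_add, map_mul, map_one, h2, Nat.cast_zero, Nat.cast_one]
    linear_combination (-PowerSeries.coeff 1 f) * hr2
  · simp only [LinearMap.map_add, LinearMap.map_sub, PowerSeries.coeff_C_mul, e1, e2 _ (n + 1),
      e3 _ n, hd, hdd]
    simp only [map_add, map_mul, map_one, h2, map_natCast, Nat.cast_add, Nat.cast_one, add_assoc, Nat.reduceAdd]
    linear_combination (-((n : A) + 2) * PowerSeries.coeff (n + 2) f) * hr2

/-- The Heun equation `D f = 0`, `f(0) = 1`, has exactly one power series solution,
namely `∑ P_i(l) x^i`. -/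
theorem heunOp_eq_zero_iff {A : Type*} [CommRing A] [Algebra ℂ A] {t s₁ s₂ s₃ r₁ r₂ : ℂ}
    (ht : t ≠ 0) (hs : ∀ n : ℕ, (n : ℂ) + s₁ ≠ 0) (hr : r₁ + r₂ = s₁ + s₂ + s₃ - 1)
    (l : A) (f : PowerSeries A) :
    (PowerSeries.coeff 0 f = 1 ∧ heunOp t s₁ s₂ s₃ r₁ r₂ l f = 0) ↔
      f = PowerSeries.mk fun i => aeval l (heunPoly t s₁ s₂ s₃ r₁ r₂ i) := by
  have inv (z : ℂ) (hz : z ≠ 0) : algebraMap ℂ A z⁻¹ * algebraMap ℂ A z = 1 := by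
    rw [← map_mul, inv_mul_cancel₀ hz, map_one]
  have i0 := inv (t * s₁) (mul_ne_zero ht (by simpa using hs 0))
  have i1 (n : ℕ) := inv (t * (n + 2) * (n + 1 + s₁))
    (mul_ne_zero (mul_ne_zero ht (by exact_mod_cast (Nat.succ_ne_zero (n + 1))))
      (by simpa using hs (n + 1)))
  have a1 : aeval l (heunPoly t s₁ s₂ s₃ r₁ r₂ 1) = -(algebraMap ℂ A (t * s₁)⁻¹ * l) := by
    simp only [heunPoly, map_neg, map_mul, aeval_C, aeval_X]
  have a2 (n : ℕ) : aeval l (heunPoly t s₁ s₂ s₃ r₁ r₂ (n + 2)) =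
      algebraMap ℂ A (t * (n + 2) * (n + 1 + s₁))⁻¹ *
        ((algebraMap ℂ A ((n + 1) * ((1 + t) * (n + s₁) + s₂ * t + s₃)) - l)
            * aeval l (heunPoly t s₁ s₂ s₃ r₁ r₂ (n + 1))
          - algebraMap ℂ A ((n + r₁) * (n + r₂)) * aeval l (heunPoly t s₁ s₂ s₃ r₁ r₂ n)) := by
    simp only [heunPoly, map_mul, map_sub, aeval_C, aeval_X]
  constructor
  · rintro ⟨h0, hD⟩
    ext n
    rw [PowerSeries.coeff_mk]
    induction n using Nat.strong_induction_on with
    | _ n ih =>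
      rcases n with _ | _ | n
      · simp [h0, heunPoly]
      · have := coeff_zero_heunOp t s₁ s₂ s₃ r₁ r₂ l f
        rw [hD, map_zero, h0] at this
        rw [zero_add, a1]
        linear_combination (-algebraMap ℂ A (t * s₁)⁻¹) * this - PowerSeries.coeff 1 f * i0
      · have := coeff_succ_heunOp t s₁ s₂ s₃ r₁ r₂ hr l f n
        rw [hD, map_zero, ih (n + 1) (by omega), ih n (by omega)] at this
        rw [show n + 1 + 1 = n + 2 from rfl, a2]
        linear_combination (-algebraMap ℂ A (t * (n + 2) * (n + 1 + s₁))⁻¹) * this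
          - PowerSeries.coeff (n + 2) f * i1 n
  · rintro rfl
    refine ⟨by simp [heunPoly], ?_⟩
    ext n
    rcases n with _ | n
    · rw [coeff_zero_heunOp, PowerSeries.coeff_mk, PowerSeries.coeff_mk, a1, map_zero]
      simp only [heunPoly, map_one]
      linear_combination (-l) * i0
    · rw [coeff_succ_heunOp _ _ _ _ _ _ hr, PowerSeries.coeff_mk, PowerSeries.coeff_mk,
        PowerSeries.coeff_mk, a2, map_zero]
      linear_combination ((algebraMap ℂ A ((n + 1) * ((1 + t) * (n + s₁) + s₂ * t + s₃)) - l)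
            * aeval l (heunPoly t s₁ s₂ s₃ r₁ r₂ (n + 1))
          - algebraMap ℂ A ((n + r₁) * (n + r₂)) * aeval l (heunPoly t s₁ s₂ s₃ r₁ r₂ n)) * i1 n

theorem degree_heunPoly {t s₁ s₂ s₃ r₁ r₂ : ℂ} (ht : t ≠ 0) (hs : ∀ n : ℕ, (n : ℂ) + s₁ ≠ 0)
    (n : ℕ) : (heunPoly t s₁ s₂ s₃ r₁ r₂ n).degree = n := by
  induction n using Nat.strong_induction_on with
  | _ n ih =>
    rcases n with _ | _ | n
    · simp [heunPoly]
    · have h : (t * s₁)⁻¹ ≠ 0 := inv_ne_zero (mul_ne_zero ht (by simpa using hs 0))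
      rw [heunPoly, degree_neg, degree_C_mul h, degree_X]
      rfl
    · have h : (t * (n + 2) * (n + 1 + s₁))⁻¹ ≠ 0 :=
        inv_ne_zero (mul_ne_zero (mul_ne_zero ht (by exact_mod_cast (Nat.succ_ne_zero (n + 1))))
          (by simpa using hs (n + 1)))
      have h1 := ih (n + 1) (by omega)
      have h0 := ih n (by omega)
      have hX (a : ℂ) : (C a - X : ℂ[X]).degree = 1 := by
        rw [← neg_sub, degree_neg, degree_X_sub_C]
      have hm (a : ℂ) : ((C a - X) * heunPoly t s₁ s₂ s₃ r₁ r₂ (n + 1)).degree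
          = ((n + 2 : ℕ) : WithBot ℕ) := by
        rw [degree_mul, hX, h1]
        norm_cast
        omega
      rw [heunPoly, degree_C_mul h, degree_sub_eq_left_of_degree_lt, hm]
      rw [hm]
      refine ((degree_mul_le _ _).trans (add_le_add degree_C_le h0.le)).trans_lt ?_
      rw [zero_add]
      exact_mod_cast (by omega : n < n + 2)

/-- The `P_i` as a sequence of polynomials with `deg P_i = i`. -/
def heunSequence (t s₁ s₂ s₃ r₁ r₂ : ℂ) (ht : t ≠ 0) (hs : ∀ n : ℕ, (n : ℂ) + s₁ ≠ 0) :
    Polynomial.Sequence ℂ where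
  elems' := heunPoly t s₁ s₂ s₃ r₁ r₂
  degree_eq' := degree_heunPoly ht hs

/-- The structure constants `C_{i,j}^k` of polynomial multiplication in the basis `S_i` of `ℂ[X]`:
`S_i S_j = ∑_k C_{i,j}^k S_k`. -/
def structConst (S : Polynomial.Sequence ℂ) (i j k : ℕ) : ℂ :=
  (S.basis fun n => (leadingCoeff_ne_zero.mpr (S.ne_zero n)).isUnit).repr (S i * S j) k

/-- `HasKernel S x₁ x₂ y K`: the series `∑_{i,j,k ≥ 0} C_{i,j}^k x₁^i x₂^j / y^(k+1)`, the
generating function of the structure constants of `S`, converges absolutely at the point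
`(x₁, x₂, y)` and its sum is `K`. -/
def HasKernel (S : Polynomial.Sequence ℂ) (x₁ x₂ y K : ℂ) : Prop :=
  HasSum (fun n : ℕ × ℕ × ℕ =>
    structConst S n.1 n.2.1 n.2.2 * x₁ ^ n.1 * x₂ ^ n.2.1 / y ^ (n.2.2 + 1)) K

theorem natCast_add_one_ne_zero (n : ℕ) : (n : ℂ) + 1 ≠ 0 := Nat.cast_add_one_ne_zero n

/-- The discriminant `P(x₁, x₂, y)`. -/
def heunDisc (t x₁ x₂ y : ℂ) : ℂ :=
  1 - 2 * x₁ / y - 2 * x₂ / y + x₁ ^ 2 / y ^ 2 + x₂ ^ 2 / y ^ 2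
    - 2 * x₁ ^ 2 * x₂ / (t * y) - 2 * x₁ * x₂ ^ 2 / (t * y) + x₁ ^ 2 * x₂ ^ 2 / t ^ 2
    + 2 * (2 * t * y - y ^ 2 - t + 2 * y) * x₁ * x₂ / (t * y ^ 2)

end

/-! Fix `y` and let `L` be the linear functional on `ℂ[X]` sending `P_k` to `1 / y^(k+1)`
(`resolvent`). Summing the kernel over `k` gives `∑ L(P_i P_j) x₁^i x₂^j`, so the task is to
identify the array `L(P_i P_j)` with the Taylor coefficients of the closed form.

The three-term recurrence of the `P_i` expresses multiplication by the accessory parameter. Applying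
it to either factor of `P_i P_j` and equating the results gives a recurrence in `(i, j)`
(`heunRec_map_mul`). Since `t (i+1)² ≠ 0`, it determines the whole array from the row `i = 0`
(`HeunRec.ext`), which here is `1 / y^(j+1)`.

For a function `F(x₁, x₂)`, the same recurrence says that the Heun operator without its accessory
term has the same effect in `x₁` as in `x₂` (`heunRec_taylorCoeff`). The closed form has this
property: the operator in `x₁` multiplies it by a factor computed from logarithmic derivatives, and
that factor is symmetric in the two variables (`heunQuot_symm`). At `x₁ = 0` the closed form is `1 /
(y - x₂)`, so the initial rows agree too (`taylorCoeff_heunKernel`).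

Convergence has two independent parts. The recurrence bounds the structure constants geometrically,
which gives absolute convergence (`HeunRec.norm_le`, `summable_kernel`). The closed form is
holomorphic for small `x₁, x₂` and large `y`, uniformly (`exists_kernelRegular`), so its Taylor
series, grouped by total degree, sums to it. Uniqueness of sums identifies the two values. -/

noncomputable section

open Filter Topology

/-! ### Iterated directional derivatives of analytic functions -/

section DirectionalDerivative

variable {E : Type*} [NormedAddCommGroup E] [NormedSpace ℂ E]

/-- The derivative of `F` in the direction `v`, as a function of the base point. -/
def dirDeriv (v : E) (F : E → ℂ) : E → ℂ := fun p => fderiv ℂ F p v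

theorem AnalyticAt.dirDeriv {v : E} {F : E → ℂ} {x : E} (hF : AnalyticAt ℂ F x) :
    AnalyticAt ℂ (dirDeriv v F) x :=
  ((ContinuousLinearMap.apply ℂ ℂ v).analyticAt _).comp hF.fderiv

theorem AnalyticAt.iterate_dirDeriv {v : E} {F : E → ℂ} {x : E} (hF : AnalyticAt ℂ F x) (n : ℕ) :
    AnalyticAt ℂ ((_root_.dirDeriv v)^[n] F) x := by
  induction n with
  | zero => exact hF
  | succ n ih => rw [Function.iterate_succ_apply']; exact ih.dirDeriv

theorem dirDeriv_congr {v : E} {F F' : E → ℂ} {x : E} (h : F =ᶠ[𝓝 x] F') :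
    dirDeriv v F =ᶠ[𝓝 x] dirDeriv v F' := by
  filter_upwards [h.fderiv (𝕜 := ℂ)] with p hp
  simp [dirDeriv, hp]

theorem iterate_dirDeriv_congr {v : E} {F F' : E → ℂ} {x : E} (h : F =ᶠ[𝓝 x] F') (n : ℕ) :
    (dirDeriv v)^[n] F =ᶠ[𝓝 x] (dirDeriv v)^[n] F' := by
  induction n with
  | zero => exact h
  | succ n ih => simp only [Function.iterate_succ_apply']; exact dirDeriv_congr ih

theorem dirDeriv_add {v : E} {F F' : E → ℂ} {x : E} (hF : AnalyticAt ℂ F x)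
    (hF' : AnalyticAt ℂ F' x) :
    dirDeriv v (F + F') =ᶠ[𝓝 x] dirDeriv v F + dirDeriv v F' := by
  filter_upwards [hF.eventually_analyticAt, hF'.eventually_analyticAt] with p hp hp'
  simp [dirDeriv, fderiv_add hp.differentiableAt hp'.differentiableAt]

theorem iterate_dirDeriv_add {v : E} {F F' : E → ℂ} {x : E} (hF : AnalyticAt ℂ F x)
    (hF' : AnalyticAt ℂ F' x) (n : ℕ) :
    (dirDeriv v)^[n] (F + F') =ᶠ[𝓝 x] (dirDeriv v)^[n] F + (dirDeriv v)^[n] F' := by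
  induction n with
  | zero => rfl
  | succ n ih =>
    simp only [Function.iterate_succ_apply']
    exact (dirDeriv_congr ih).trans (dirDeriv_add (hF.iterate_dirDeriv n) (hF'.iterate_dirDeriv n))

theorem dirDeriv_const_smul (v : E) (c : ℂ) {F : E → ℂ} :
    dirDeriv v (c • F) = c • dirDeriv v F := by
  ext p
  simp [dirDeriv, fderiv_const_smul_field]

theorem iterate_dirDeriv_const_smul (v : E) (c : ℂ) (F : E → ℂ) (n : ℕ) :
    (dirDeriv v)^[n] (c • F) = c • (dirDeriv v)^[n] F := by
  induction n with
  | zero => rfl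
  | succ n ih => simp only [Function.iterate_succ_apply', ih, dirDeriv_const_smul]

theorem dirDeriv_clm_mul (l : E →L[ℂ] ℂ) {v : E} {F : E → ℂ} {x : E} (hF : AnalyticAt ℂ F x) :
    dirDeriv v (⇑l * F) =ᶠ[𝓝 x] ⇑l * dirDeriv v F + l v • F := by
  filter_upwards [hF.eventually_analyticAt] with p hp
  simp [dirDeriv, fderiv_mul l.differentiableAt hp.differentiableAt]
  ring

/-- Leibniz rule: `l` is linear, so only two terms survive. At `n = 0` the truncated `n - 1` is
harmless because its term carries the factor `n`. -/
theorem iterate_dirDeriv_clm_mul (l : E →L[ℂ] ℂ) {v : E} {F : E → ℂ} {x : E}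
    (hF : AnalyticAt ℂ F x) (n : ℕ) :
    (dirDeriv v)^[n] (⇑l * F) =ᶠ[𝓝 x]
      ⇑l * (dirDeriv v)^[n] F + (n * l v) • (dirDeriv v)^[n - 1] F := by
  induction n with
  | zero => simp
  | succ n ih =>
    have h1 : AnalyticAt ℂ (⇑l * (dirDeriv v)^[n] F) x :=
      (l.analyticAt x).mul (hF.iterate_dirDeriv n)
    have h2 : AnalyticAt ℂ ((n * l v) • (dirDeriv v)^[n - 1] F) x :=
      (hF.iterate_dirDeriv (n - 1)).const_smul
    rw [Function.iterate_succ_apply']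
    refine (dirDeriv_congr ih).trans ((dirDeriv_add h1 h2).trans ?_)
    filter_upwards [dirDeriv_clm_mul l (v := v) (hF.iterate_dirDeriv (v := v) n)] with p hp
    rw [dirDeriv_const_smul, Pi.add_apply, hp]
    rcases n with _ | n
    · simp
    · simp [← Function.iterate_succ_apply']
      ring

theorem dirDeriv_comm {v w : E} {F : E → ℂ} {x : E} (hF : AnalyticAt ℂ F x) :
    dirDeriv v (dirDeriv w F) =ᶠ[𝓝 x] dirDeriv w (dirDeriv v F) := by
  filter_upwards [hF.eventually_analyticAt] with p hp
  have h := (hp.contDiffAt (n := ⊤)).isSymmSndFDerivAt_of_omega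
  have key (a b : E) : dirDeriv a (dirDeriv b F) p = fderiv ℂ (fderiv ℂ F) p a b := by
    unfold dirDeriv
    rw [fderiv_clm_apply hp.fderiv.differentiableAt (differentiableAt_const _)]
    simp
  rw [key, key]
  exact h v w

theorem iterate_dirDeriv_comm {v w : E} {F : E → ℂ} {x : E} (hF : AnalyticAt ℂ F x) (n : ℕ) :
    (dirDeriv v)^[n] (dirDeriv w F) =ᶠ[𝓝 x] dirDeriv w ((dirDeriv v)^[n] F) := by
  induction n with
  | zero => rfl
  | succ n ih =>
    simp only [Function.iterate_succ_apply']
    exact (dirDeriv_congr ih).trans (dirDeriv_comm (hF.iterate_dirDeriv n))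

/-- Restriction to a complex line through the origin makes the one-variable Taylor theorem available
in two variables. -/
theorem iteratedDeriv_comp_smul (v : E) {F : E → ℂ} (hF : AnalyticAt ℂ F 0) (n : ℕ) :
    iteratedDeriv n (fun s : ℂ => F (s • v)) 0 = (dirDeriv v)^[n] F 0 := by
  have hc : Tendsto (fun s : ℂ => s • v) (𝓝 0) (𝓝 0) := by
    have : Continuous fun s : ℂ => s • v := by fun_prop
    simpa using this.tendsto 0
  have : iteratedDeriv n (fun s : ℂ => F (s • v)) =ᶠ[𝓝 0]
      fun s => (dirDeriv v)^[n] F (s • v) := by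
    induction n with
    | zero => simp
    | succ n ih =>
      rw [iteratedDeriv_succ, Function.iterate_succ_apply']
      refine ih.deriv.trans ?_
      filter_upwards [hc.eventually (hF.iterate_dirDeriv (v := v) n).eventually_analyticAt] with s hs
      have h1 : HasDerivAt (fun s : ℂ => s • v) v s := by
        simpa using (hasDerivAt_id s).smul_const v
      exact (hs.differentiableAt.hasFDerivAt.comp_hasDerivAt s h1).deriv
  simpa using this.self_of_nhds

end DirectionalDerivative

/-! ### Double Taylor series on `ℂ × ℂ` -/

section TaylorCoefficients

/-- The mixed partial derivative `∂₁^i ∂₂^j F` at the origin of `ℂ × ℂ`. -/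
def mixedDeriv (F : ℂ × ℂ → ℂ) (i j : ℕ) : ℂ :=
  (dirDeriv (1, 0))^[i] ((dirDeriv (0, 1))^[j] F) 0

theorem mixedDeriv_congr {F F' : ℂ × ℂ → ℂ} (h : F =ᶠ[𝓝 0] F') (i j : ℕ) :
    mixedDeriv F i j = mixedDeriv F' i j :=
  (iterate_dirDeriv_congr (iterate_dirDeriv_congr h j) i).self_of_nhds

theorem mixedDeriv_add {F F' : ℂ × ℂ → ℂ} (hF : AnalyticAt ℂ F 0) (hF' : AnalyticAt ℂ F' 0)
    (i j : ℕ) : mixedDeriv (F + F') i j = mixedDeriv F i j + mixedDeriv F' i j :=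
  ((iterate_dirDeriv_congr (iterate_dirDeriv_add hF hF' j) i).trans
    (iterate_dirDeriv_add (hF.iterate_dirDeriv j) (hF'.iterate_dirDeriv j) i)).self_of_nhds

theorem mixedDeriv_const_smul (c : ℂ) (F : ℂ × ℂ → ℂ) (i j : ℕ) :
    mixedDeriv (c • F) i j = c * mixedDeriv F i j := by
  simp [mixedDeriv, iterate_dirDeriv_const_smul]

theorem mixedDeriv_dirDeriv_fst {F : ℂ × ℂ → ℂ} (hF : AnalyticAt ℂ F 0) (i j : ℕ) :
    mixedDeriv (dirDeriv (1, 0) F) i j = mixedDeriv F (i + 1) j :=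
  (iterate_dirDeriv_congr (iterate_dirDeriv_comm hF j) i).self_of_nhds

theorem mixedDeriv_dirDeriv_snd (F : ℂ × ℂ → ℂ) (i j : ℕ) :
    mixedDeriv (dirDeriv (0, 1) F) i j = mixedDeriv F i (j + 1) := rfl

theorem mixedDeriv_fst_mul {F : ℂ × ℂ → ℂ} (hF : AnalyticAt ℂ F 0) (i j : ℕ) :
    mixedDeriv (Prod.fst * F) i j = i * mixedDeriv F (i - 1) j := by
  have h1 := iterate_dirDeriv_clm_mul (ContinuousLinearMap.fst ℂ ℂ ℂ) (v := (0, 1)) hF j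
  have h2 := iterate_dirDeriv_clm_mul (ContinuousLinearMap.fst ℂ ℂ ℂ) (v := (1, 0))
    (hF.iterate_dirDeriv (v := (0, 1)) j) i
  simp at h1 h2
  have := ((iterate_dirDeriv_congr (v := (1, 0)) h1 i).trans h2).self_of_nhds
  simpa [mixedDeriv] using this

theorem mixedDeriv_snd_mul {F : ℂ × ℂ → ℂ} (hF : AnalyticAt ℂ F 0) (i j : ℕ) :
    mixedDeriv (Prod.snd * F) i j = j * mixedDeriv F i (j - 1) := by
  have h1 := iterate_dirDeriv_clm_mul (ContinuousLinearMap.snd ℂ ℂ ℂ) (v := (0, 1)) hF j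
  have h2 := iterate_dirDeriv_clm_mul (ContinuousLinearMap.snd ℂ ℂ ℂ) (v := (1, 0))
    (hF.iterate_dirDeriv (v := (0, 1)) j) i
  simp at h1 h2
  have h3 := (iterate_dirDeriv_congr (v := (1, 0)) h1 i).self_of_nhds
  have h4 := (iterate_dirDeriv_add (v := (1, 0)) (x := (0 : ℂ × ℂ))
    (F := Prod.snd * (dirDeriv (0, 1))^[j] F)
    (F' := (j : ℂ) • (dirDeriv (0, 1))^[j - 1] F)
    (analyticAt_snd.mul (hF.iterate_dirDeriv j)) (hF.iterate_dirDeriv (j - 1)).const_smul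
    i).self_of_nhds
  have h5 := h2.self_of_nhds
  simp [iterate_dirDeriv_const_smul] at h3 h4 h5
  unfold mixedDeriv
  rw [h3, h4, h5]
  simp

/-- The Taylor coefficient of `x₁^i x₂^j` in `F`. -/
def taylorCoeff (F : ℂ × ℂ → ℂ) (i j : ℕ) : ℂ :=
  mixedDeriv F i j / (i.factorial * j.factorial)

theorem taylorCoeff_dirDeriv_fst {F : ℂ × ℂ → ℂ} (hF : AnalyticAt ℂ F 0) (i j : ℕ) :
    taylorCoeff (dirDeriv (1, 0) F) i j = (i + 1) * taylorCoeff F (i + 1) j := by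
  have h1 : (i.factorial : ℂ) ≠ 0 := by exact_mod_cast i.factorial_ne_zero
  have h2 : (j.factorial : ℂ) ≠ 0 := by exact_mod_cast j.factorial_ne_zero
  have h3 : (i : ℂ) + 1 ≠ 0 := Nat.cast_add_one_ne_zero i
  rw [taylorCoeff, taylorCoeff, mixedDeriv_dirDeriv_fst hF, Nat.factorial_succ]
  push_cast
  field_simp

theorem taylorCoeff_dirDeriv_snd (F : ℂ × ℂ → ℂ) (i j : ℕ) :
    taylorCoeff (dirDeriv (0, 1) F) i j = (j + 1) * taylorCoeff F i (j + 1) := by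
  have h1 : (i.factorial : ℂ) ≠ 0 := by exact_mod_cast i.factorial_ne_zero
  have h2 : (j.factorial : ℂ) ≠ 0 := by exact_mod_cast j.factorial_ne_zero
  have h3 : (j : ℂ) + 1 ≠ 0 := Nat.cast_add_one_ne_zero j
  rw [taylorCoeff, taylorCoeff, mixedDeriv_dirDeriv_snd, Nat.factorial_succ]
  push_cast
  field_simp

-- This is the expansion of `(x₁ ∂₁ + x₂ ∂₂)^n`. The induction peels off the innermost derivative,
-- so `F` has to vary.
open Finset in
theorem iterate_dirDeriv_eq_sum_taylorCoeff (x₁ x₂ : ℂ) {F : ℂ × ℂ → ℂ} (hF : AnalyticAt ℂ F 0)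
    (n : ℕ) : (dirDeriv (x₁, x₂))^[n] F 0 =
      n.factorial * ∑ ij ∈ antidiagonal n, taylorCoeff F ij.1 ij.2 * x₁ ^ ij.1 * x₂ ^ ij.2 := by
  induction n generalizing F with
  | zero => simp [taylorCoeff, mixedDeriv]
  | succ n ih =>
    have hd : dirDeriv (x₁, x₂) F = x₁ • dirDeriv (1, 0) F + x₂ • dirDeriv (0, 1) F := by
      ext p
      have : ((x₁, x₂) : ℂ × ℂ) = x₁ • (1, 0) + x₂ • (0, 1) := by simp
      simp only [dirDeriv, this, map_add, map_smul, Pi.add_apply, Pi.smul_apply]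
    have h1 : AnalyticAt ℂ (dirDeriv (1, 0) F) 0 := hF.dirDeriv
    have h2 : AnalyticAt ℂ (dirDeriv (0, 1) F) 0 := hF.dirDeriv
    have hadd := (iterate_dirDeriv_add (v := (x₁, x₂))
      (h1.const_smul (c := x₁)) (h2.const_smul (c := x₂)) n).self_of_nhds
    rw [Function.iterate_succ_apply, hd, hadd, iterate_dirDeriv_const_smul,
      iterate_dirDeriv_const_smul]
    simp only [Pi.add_apply, Pi.smul_apply, smul_eq_mul]
    rw [ih h1, ih h2, Nat.factorial_succ]
    -- On the antidiagonal `n + 1 = i + j`; the two parts correspond to `x₁ ∂₁` and `x₂ ∂₂`.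
    have hsplit : ((n + 1 : ℕ) : ℂ) *
        ∑ ij ∈ antidiagonal (n + 1), taylorCoeff F ij.1 ij.2 * x₁ ^ ij.1 * x₂ ^ ij.2 =
        (∑ ij ∈ antidiagonal (n + 1), ij.1 * (taylorCoeff F ij.1 ij.2 * x₁ ^ ij.1 * x₂ ^ ij.2)) +
        ∑ ij ∈ antidiagonal (n + 1), ij.2 * (taylorCoeff F ij.1 ij.2 * x₁ ^ ij.1 * x₂ ^ ij.2) := by
      rw [← sum_add_distrib, mul_sum]
      refine sum_congr rfl fun ij hij => ?_
      rw [← mem_antidiagonal.mp hij]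
      push_cast
      ring
    push_cast at hsplit ⊢
    rw [mul_comm ((n : ℂ) + 1), mul_assoc, hsplit, Nat.sum_antidiagonal_succ,
      Nat.sum_antidiagonal_succ' (n := n)]
    simp only [taylorCoeff_dirDeriv_fst hF, taylorCoeff_dirDeriv_snd, mul_sum, mul_add]
    simp only [Nat.cast_zero, zero_mul, mul_zero, zero_add, Nat.cast_add, Nat.cast_one]
    congr 1 <;> exact sum_congr rfl fun ij _ => by ring

open Finset in
/-- A holomorphic function is the sum of its double Taylor series, summed by total degree. -/
theorem hasSum_taylorCoeff {F : ℂ × ℂ → ℂ} (hF : AnalyticAt ℂ F 0) {x₁ x₂ : ℂ}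
    (h : ∀ s : ℂ, ‖s‖ < 2 → DifferentiableAt ℂ F (s * x₁, s * x₂)) :
    HasSum (fun n => ∑ ij ∈ antidiagonal n,
      taylorCoeff F ij.1 ij.2 * x₁ ^ ij.1 * x₂ ^ ij.2) (F (x₁, x₂)) := by
  have hd : DifferentiableOn ℂ (fun s : ℂ => F (s • (x₁, x₂))) (Metric.ball 0 2) := by
    intro s hs
    have h1 := h s (by simpa using hs)
    have h2 : DifferentiableAt ℂ (fun s : ℂ => s • (x₁, x₂)) s := by fun_prop
    exact (DifferentiableAt.comp s (g := F) h1 h2).differentiableWithinAt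
  -- Radius `2` puts the evaluation point `s = 1` inside the disc.
  have key := Complex.hasSum_taylorSeries_on_ball hd (z := 1) (by simp)
  simp only [iteratedDeriv_comp_smul _ hF, iterate_dirDeriv_eq_sum_taylorCoeff _ _ hF] at key
  have hn (n : ℕ) : (n.factorial : ℂ) ≠ 0 := by exact_mod_cast n.factorial_ne_zero
  simpa [hn] using key

end TaylorCoefficients

/-! ### The recurrence for products of the `P_i`, and its growth -/

section StructureConstants

/-- Multiplication by the accessory parameter in the basis of the `P_i`. -/
theorem X_mul_heunPoly {t s₂ s₃ r₂ : ℂ} (ht : t ≠ 0) (n : ℕ) :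
    X * heunPoly t 1 s₂ s₃ 1 r₂ n =
      C (n * ((1 + t) * n + s₂ * t + s₃)) * heunPoly t 1 s₂ s₃ 1 r₂ n
        - C (t * (n + 1) ^ 2) * heunPoly t 1 s₂ s₃ 1 r₂ (n + 1)
        - C (n * (n - 1 + r₂)) * heunPoly t 1 s₂ s₃ 1 r₂ (n - 1) := by
  rcases n with _ | n
  · simp only [heunPoly]
    have : C t * C t⁻¹ = (1 : ℂ[X]) := by rw [← C_mul, mul_inv_cancel₀ ht, C_1]
    simp
    linear_combination (-X) * this
  · have h : t * (n + 2) * (n + 1 + 1) ≠ 0 :=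
      mul_ne_zero (mul_ne_zero ht (by exact_mod_cast (Nat.succ_ne_zero (n + 1))))
        (by exact_mod_cast (Nat.succ_ne_zero (n + 1)))
    have h' : C (t * ((n : ℂ) + 1 + 1) ^ 2) * C (t * (n + 2) * (n + 1 + 1))⁻¹ = (1 : ℂ[X]) := by
      rw [← C_mul, show t * ((n : ℂ) + 1 + 1) ^ 2 = t * (n + 2) * (n + 1 + 1) by ring,
        mul_inv_cancel₀ h, C_1]
    rw [heunPoly, Nat.add_sub_cancel]
    push_cast
    rw [← mul_assoc, h', one_mul]
    rw [show ((n : ℂ) + 1 - 1 + r₂) = n + r₂ by ring, mul_comm ((n : ℂ) + 1) (n + r₂)]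
    ring

/-- The recurrence in `i` and `j` satisfied by the products `P_i P_j` under any linear functional,
and by the Taylor coefficients of the kernel in `(x₁, x₂)`. -/
def HeunRec (t s₂ s₃ r₂ : ℂ) (e : ℕ → ℕ → ℂ) : Prop :=
  ∀ i j : ℕ,
    t * (i + 1) ^ 2 * e (i + 1) j - i * ((1 + t) * i + s₂ * t + s₃) * e i j
        + i * (i - 1 + r₂) * e (i - 1) j =
      t * (j + 1) ^ 2 * e i (j + 1) - j * ((1 + t) * j + s₂ * t + s₃) * e i j
        + j * (j - 1 + r₂) * e i (j - 1)

/-- Both sides are, up to sign, `l` applied to what remains of `X P_i P_j` after expanding `X P_i`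
or `X P_j`. An arbitrary `l` serves both the coordinate functionals, for the estimates, and
`resolvent`, for the closed form. -/
theorem heunRec_map_mul {t s₂ s₃ r₂ : ℂ} (ht : t ≠ 0) (l : ℂ[X] →ₗ[ℂ] ℂ) :
    HeunRec t s₂ s₃ r₂ fun i j =>
      l (heunPoly t 1 s₂ s₃ 1 r₂ i * heunPoly t 1 s₂ s₃ 1 r₂ j) := by
  intro i j
  have h (a : ℂ) (p : ℂ[X]) : a * l p = l (C a * p) := by
    rw [← smul_eq_C_mul, map_smul, smul_eq_mul]
  simp only [h, ← map_sub, ← map_add]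
  refine congrArg l ?_
  have hi := X_mul_heunPoly (s₂ := s₂) (s₃ := s₃) (r₂ := r₂) ht i
  have hj := X_mul_heunPoly (s₂ := s₂) (s₃ := s₃) (r₂ := r₂) ht j
  linear_combination heunPoly t 1 s₂ s₃ 1 r₂ j * hi - heunPoly t 1 s₂ s₃ 1 r₂ i * hj

theorem HeunRec.ext {t s₂ s₃ r₂ : ℂ} (ht : t ≠ 0) {e e' : ℕ → ℕ → ℂ}
    (h : HeunRec t s₂ s₃ r₂ e) (h' : HeunRec t s₂ s₃ r₂ e') (h0 : ∀ j, e 0 j = e' 0 j) (i j : ℕ) :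
    e i j = e' i j := by
  induction i using Nat.strong_induction_on generalizing j with
  | _ i ih =>
    rcases i with _ | i
    · exact h0 j
    · have a := h i j
      have b := h' i j
      have hp : (i : ℂ) * (i - 1 + r₂) * e (i - 1) j = i * (i - 1 + r₂) * e' (i - 1) j := by
        rw [ih (i - 1) (by omega)]
      rw [hp, ih i (by omega), ih i (by omega), ih i (by omega)] at a
      have hi : t * ((i : ℂ) + 1) ^ 2 ≠ 0 :=
        mul_ne_zero ht (pow_ne_zero 2 (Nat.cast_add_one_ne_zero i))
      refine mul_left_cancel₀ hi ?_
      linear_combination a - b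

/-- The growth of a solution of the recurrence is controlled by squared binomial coefficients. -/
theorem HeunRec.norm_le {t s₂ s₃ r₂ : ℂ} (ht : t ≠ 0) : ∃ A : ℝ, 1 ≤ A ∧
    ∀ (e : ℕ → ℕ → ℂ) (w : ℝ), HeunRec t s₂ s₃ r₂ e → 0 ≤ w → (∀ j, ‖e 0 j‖ ≤ w * 2 ^ j) →
      ∀ i j, ‖e i j‖ ≤ w * A ^ i * ((i + j).choose i : ℝ) ^ 2 * 2 ^ (i + j) := by
  -- `M ‖t‖ (i + j + 1)²` dominates each of the four lower-order coefficients of the recurrence.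
  -- Solving for `e (i + 1) j` then costs `1` for the term `e i (j + 1)` and `M` for each of the
  -- other four, whence `1 + 4 * M`.
  set M : ℝ := (‖1 + t‖ + ‖s₂ * t + s₃‖ + 1 + ‖r₂‖) / ‖t‖ with hM
  have ht' : 0 < ‖t‖ := norm_pos_iff.mpr ht
  have hM0 : 0 ≤ M := by positivity
  refine ⟨1 + 4 * M, by linarith, fun e w h hw h0 i => ?_⟩
  set A : ℝ := 1 + 4 * M with hA
  have hA1 : 1 ≤ A := by linarith
  have hMt : M * ‖t‖ = ‖1 + t‖ + ‖s₂ * t + s₃‖ + 1 + ‖r₂‖ := div_mul_cancel₀ _ ht'.ne'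
  have hα (n m : ℕ) (hnm : n ≤ m) :
      ‖(n : ℂ) * ((1 + t) * n + s₂ * t + s₃)‖ ≤ M * ‖t‖ * (m + 1) ^ 2 := by
    have hnm' : (n : ℝ) ≤ m := by exact_mod_cast hnm
    have hn : (0 : ℝ) ≤ n := n.cast_nonneg
    calc ‖(n : ℂ) * ((1 + t) * n + s₂ * t + s₃)‖
        = n * ‖(1 + t) * n + (s₂ * t + s₃)‖ := by rw [norm_mul, Complex.norm_natCast, add_assoc]
      _ ≤ n * (‖1 + t‖ * n + ‖s₂ * t + s₃‖) := by
          gcongr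
          exact (norm_add_le _ _).trans (by rw [norm_mul, Complex.norm_natCast])
      _ ≤ (m + 1) * ((M * ‖t‖) * (m + 1)) := by
          gcongr
          · linarith
          · rw [hMt]
            nlinarith [norm_nonneg (1 + t), norm_nonneg (s₂ * t + s₃), norm_nonneg r₂,
              mul_nonneg (norm_nonneg (1 + t)) (sub_nonneg.mpr hnm'),
              mul_nonneg (norm_nonneg (s₂ * t + s₃)) (hn.trans hnm'),
              mul_nonneg (norm_nonneg r₂) (hn.trans hnm')]
      _ = _ := by ring
  have hβ (n m : ℕ) (hnm : n ≤ m) :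
      ‖(n : ℂ) * (n - 1 + r₂)‖ ≤ M * ‖t‖ * (m + 1) ^ 2 := by
    have hnm' : (n : ℝ) ≤ m := by exact_mod_cast hnm
    have hn : (0 : ℝ) ≤ n := n.cast_nonneg
    calc ‖(n : ℂ) * (n - 1 + r₂)‖
        = n * ‖(n : ℂ) - 1 + r₂‖ := by rw [norm_mul, Complex.norm_natCast]
      _ ≤ n * (n + 1 + ‖r₂‖) := by
          gcongr
          refine (norm_add_le _ _).trans (add_le_add_left ((norm_sub_le _ _).trans ?_) _)
          simp
      _ ≤ (m + 1) * ((M * ‖t‖) * (m + 1)) := by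
          gcongr
          · linarith
          · rw [hMt]
            nlinarith [norm_nonneg (1 + t), norm_nonneg (s₂ * t + s₃), norm_nonneg r₂,
              mul_nonneg (norm_nonneg (1 + t)) (hn.trans hnm'),
              mul_nonneg (norm_nonneg (s₂ * t + s₃)) (hn.trans hnm'),
              mul_nonneg (norm_nonneg r₂) (hn.trans hnm')]
      _ = _ := by ring
  induction i using Nat.strong_induction_on with
  | _ i ih =>
    intro j
    rcases i with _ | i
    · simpa using h0 j
    · set B : ℝ := w * A ^ i * ((i + j).choose i : ℝ) ^ 2 * 2 ^ (i + j) with hB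
      set T : ℝ := w * A ^ i * ((i + 1 + j).choose (i + 1) : ℝ) ^ 2 * 2 ^ (i + 1 + j) with hT
      have hB0 : 0 ≤ B := by positivity
      -- The squared binomial is chosen for `c1` and `c2`: they convert the factors `(j + 1)²` and
      -- `(i + j + 1)²` on the right of the recurrence into the `(i + 1)²` on the left.
      have c1 : ((i + (j + 1)).choose i : ℝ) * (j + 1) =
          ((i + 1 + j).choose (i + 1) : ℝ) * (i + 1) := by
        have := Nat.choose_succ_right_eq (i + 1 + j) i
        rw [show i + 1 + j - i = j + 1 by omega] at this
        rw [show i + (j + 1) = i + 1 + j by omega]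
        exact_mod_cast this.symm
      have c2 : ((i : ℝ) + j + 1) * ((i + j).choose i : ℝ) =
          ((i + 1 + j).choose (i + 1) : ℝ) * (i + 1) := by
        have := Nat.add_one_mul_choose_eq (i + j) i
        rw [show i + j + 1 = i + 1 + j by omega] at this
        rw [← Nat.cast_succ i, ← Nat.cast_mul, ← this]
        push_cast
        ring
      have b1 : (j + 1) ^ 2 * ‖e i (j + 1)‖ ≤ (i + 1) ^ 2 * T := by
        calc (j + 1) ^ 2 * ‖e i (j + 1)‖
            ≤ (j + 1) ^ 2 * (w * A ^ i * ((i + (j + 1)).choose i : ℝ) ^ 2 * 2 ^ (i + (j + 1))) := by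
              gcongr
              exact ih i (by omega) (j + 1)
          _ = w * A ^ i * (((i + (j + 1)).choose i : ℝ) * (j + 1)) ^ 2 * 2 ^ (i + 1 + j) := by
              rw [show i + 1 + j = i + (j + 1) by omega]
              ring
          _ = _ := by rw [c1, hT]; ring
      have b2 : ‖e i j‖ ≤ B := ih i (by omega) j
      have b5 : ((i + j : ℕ) + 1) ^ 2 * B ≤ (i + 1) ^ 2 * T := by
        calc ((i + j : ℕ) + 1) ^ 2 * B
            = w * A ^ i * (((i : ℝ) + j + 1) * ((i + j).choose i : ℝ)) ^ 2 * 2 ^ (i + j) := by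
              rw [hB]; push_cast; ring
          _ ≤ w * A ^ i * (((i : ℝ) + j + 1) * ((i + j).choose i : ℝ)) ^ 2 * 2 ^ (i + 1 + j) := by
              gcongr
              · norm_num
              · omega
          _ = _ := by rw [c2, hT]; ring
      have d3 : ‖e i (j - 1)‖ ≤ B := by
        refine (ih i (by omega) (j - 1)).trans ?_
        have : ((i + (j - 1)).choose i : ℝ) ≤ ((i + j).choose i : ℝ) := by
          exact_mod_cast Nat.choose_le_choose i (by omega)
        rw [hB]
        gcongr
        · norm_num
        · omega
      have d4 : ‖e (i - 1) j‖ ≤ B := by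
        refine (ih (i - 1) (by omega) j).trans ?_
        have : ((i - 1 + j).choose (i - 1) : ℝ) ≤ ((i + j).choose i : ℝ) := by
          rw [Nat.choose_symm_add, Nat.choose_symm_add]
          exact_mod_cast Nat.choose_le_choose j (by omega)
        rw [hB]
        gcongr
        · omega
        · norm_num
        · omega
      have hmul {a b : ℂ} (ha : ‖a‖ ≤ M * ‖t‖ * ((i + j : ℕ) + 1) ^ 2) (hb : ‖b‖ ≤ B) :
          ‖a * b‖ ≤ M * ‖t‖ * ((i + 1) ^ 2 * T) := by
        rw [norm_mul]
        refine (mul_le_mul ha hb (norm_nonneg _) (by positivity)).trans ?_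
        rw [mul_assoc]
        gcongr
      have m1 := hmul (hα i (i + j) (by omega)) b2
      have m2 := hmul (hα j (i + j) (by omega)) b2
      have m3 := hmul (hβ j (i + j) (by omega)) d3
      have m4 := hmul (hβ i (i + j) (by omega)) d4
      have m5 : ‖t * (j + 1) ^ 2 * e i (j + 1)‖ ≤ ‖t‖ * ((i + 1) ^ 2 * T) := by
        rw [mul_assoc, norm_mul, norm_mul, norm_pow, ← Nat.cast_succ, Complex.norm_natCast]
        push_cast
        gcongr
      have heq : t * (i + 1) ^ 2 * e (i + 1) j = t * (j + 1) ^ 2 * e i (j + 1)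
          - j * ((1 + t) * j + s₂ * t + s₃) * e i j + j * (j - 1 + r₂) * e i (j - 1)
          + i * ((1 + t) * i + s₂ * t + s₃) * e i j - i * (i - 1 + r₂) * e (i - 1) j := by
        linear_combination h i j
      have hle : ‖t * (i + 1) ^ 2 * e (i + 1) j‖ ≤ A * (‖t‖ * ((i + 1) ^ 2 * T)) := by
        rw [heq]
        refine (norm_sub_le _ _).trans ?_
        refine (add_le_add_left (norm_add_le _ _) _).trans ?_
        refine (add_le_add_left (add_le_add_left (norm_add_le _ _) _) _).trans ?_
        refine (add_le_add_left (add_le_add_left (add_le_add_left (norm_sub_le _ _) _) _) _).trans ?_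
        rw [hA]
        linarith
      rw [mul_assoc, norm_mul, norm_mul, norm_pow, ← Nat.cast_succ, Complex.norm_natCast] at hle
      have hpos : 0 < ‖t‖ * ((i + 1 : ℕ) : ℝ) ^ 2 := by positivity
      refine le_of_mul_le_mul_left ?_ hpos
      calc ‖t‖ * ((i + 1 : ℕ) : ℝ) ^ 2 * ‖e (i + 1) j‖
          = ‖t‖ * (((i + 1 : ℕ) : ℝ) ^ 2 * ‖e (i + 1) j‖) := by ring
        _ ≤ _ := hle
        _ = _ := by rw [hT]; push_cast; ring

end StructureConstants

/-! ### Summation over `k`, and absolute convergence -/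

section Kernel

/-- The coordinate functionals of the basis of polynomials `S_i`. -/
def Polynomial.Sequence.coord (S : Polynomial.Sequence ℂ) : ℂ[X] ≃ₗ[ℂ] (ℕ →₀ ℂ) :=
  (S.basis fun n => (leadingCoeff_ne_zero.mpr (S.ne_zero n)).isUnit).repr

theorem Polynomial.Sequence.coord_apply_self (S : Polynomial.Sequence ℂ) (j : ℕ) :
    S.coord (S j) = Finsupp.single j 1 := by
  have := (S.basis fun n => (leadingCoeff_ne_zero.mpr (S.ne_zero n)).isUnit).repr_self j
  rwa [Polynomial.Sequence.basis_eq_self] at this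

theorem structConst_eq_coord (S : Polynomial.Sequence ℂ) (i j k : ℕ) :
    structConst S i j k = S.coord (S i * S j) k := rfl

/-- The linear functional on `ℂ[X]` sending `S_k` to `1 / y^(k+1)`. -/
def Polynomial.Sequence.resolvent (S : Polynomial.Sequence ℂ) (y : ℂ) : ℂ[X] →ₗ[ℂ] ℂ :=
  Finsupp.linearCombination ℂ (fun k => (y ^ (k + 1))⁻¹) ∘ₗ S.coord.toLinearMap

theorem Polynomial.Sequence.resolvent_apply_self (S : Polynomial.Sequence ℂ) (y : ℂ) (j : ℕ) :
    S.resolvent y (S j) = (y ^ (j + 1))⁻¹ := by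
  simp [resolvent, coord_apply_self]

theorem Polynomial.Sequence.hasSum_resolvent (S : Polynomial.Sequence ℂ) (y : ℂ) (p : ℂ[X]) :
    HasSum (fun k => S.coord p k / y ^ (k + 1)) (S.resolvent y p) := by
  rw [resolvent, LinearMap.comp_apply, LinearEquiv.coe_coe, Finsupp.linearCombination_apply,
    Finsupp.sum]
  simp only [smul_eq_mul, ← div_eq_mul_inv]
  refine hasSum_sum_of_ne_finset_zero fun k hk => ?_
  rw [Finsupp.notMem_support_iff.mp hk, zero_div]

/-- If the kernel converges absolutely, it can be summed by total degree in `(x₁, x₂)`. -/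
theorem hasKernel_of_hasSum {S : Polynomial.Sequence ℂ} {x₁ x₂ y K : ℂ}
    (hs : Summable fun n : ℕ × ℕ × ℕ =>
      structConst S n.1 n.2.1 n.2.2 * x₁ ^ n.1 * x₂ ^ n.2.1 / y ^ (n.2.2 + 1))
    (hK : HasSum (fun n => ∑ ij ∈ Finset.HasAntidiagonal.antidiagonal n,
      S.resolvent y (S ij.1 * S ij.2) * x₁ ^ ij.1 * x₂ ^ ij.2) K) :
    HasKernel S x₁ x₂ y K := by
  obtain ⟨K', hK'⟩ := hs
  have h1 := (Equiv.prodAssoc ℕ ℕ ℕ).hasSum_iff.mpr hK'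
  have h2 : HasSum (fun ij : ℕ × ℕ => S.resolvent y (S ij.1 * S ij.2) * x₁ ^ ij.1 * x₂ ^ ij.2)
      K' := by
    refine h1.prod_fiberwise fun ij => ?_
    have h := (S.hasSum_resolvent y (S ij.1 * S ij.2)).mul_right (x₁ ^ ij.1 * x₂ ^ ij.2)
    rw [← mul_assoc] at h
    refine Eq.subst (motive := fun f => HasSum f _) (funext fun k => ?_) h
    simp only [Function.comp_apply, Equiv.prodAssoc_apply, structConst_eq_coord]
    ring
  -- Absolute convergence permits regrouping by `i + j`; the value is then forced by uniqueness of
  -- the sum.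
  have h3 := Finset.HasAntidiagonal.sigmaAntidiagonalEquivProd.hasSum_iff.mpr h2
  have h4 := h3.sigma fun n => hasSum_fintype _
  have h5 : K' = K := by
    refine h4.unique (Eq.subst (motive := fun f => HasSum f K) (funext fun n => ?_) hK)
    rw [← Finset.sum_coe_sort]
    rfl
  rw [← h5]
  exact hK'

/-- For fixed `k` the structure constants solve the recurrence with initial row `δ_{jk} ≤ 2^(-k)
2^j`. The weight `2^(-k)` supplies geometric decay in `k`, so `1 ≤ ‖y‖` is enough. -/
theorem summable_kernel {t s₂ s₃ r₂ : ℂ} (ht : t ≠ 0) : ∃ ε : ℝ, 0 < ε ∧ ∀ x₁ x₂ y : ℂ,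
    ‖x₁‖ < ε → ‖x₂‖ < ε → 1 ≤ ‖y‖ → Summable fun n : ℕ × ℕ × ℕ =>
      structConst (heunSequence t 1 s₂ s₃ 1 r₂ ht natCast_add_one_ne_zero) n.1 n.2.1 n.2.2
        * x₁ ^ n.1 * x₂ ^ n.2.1 / y ^ (n.2.2 + 1) := by
  obtain ⟨A, hA, hbound⟩ := HeunRec.norm_le (s₂ := s₂) (s₃ := s₃) (r₂ := r₂) ht
  set S := heunSequence t 1 s₂ s₃ 1 r₂ ht natCast_add_one_ne_zero
  have hC (i j k : ℕ) : ‖structConst S i j k‖ ≤ (1 / 2) ^ k * (8 * A) ^ i * 8 ^ j := by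
    have h1 := hbound (fun i j => structConst S i j k) ((1 / 2) ^ k)
      (heunRec_map_mul ht (Finsupp.lapply k ∘ₗ S.coord.toLinearMap)) (by positivity) ?_ i j
    · refine h1.trans ?_
      -- The squared binomial gives `4^(i+j)`, and the remaining `2^(i+j)` raises this to `8^(i+j)`.
      have h2 : ((i + j).choose i : ℝ) ≤ 2 ^ (i + j) := by
        exact_mod_cast Nat.choose_le_two_pow (i + j) i
      calc (1 / 2 : ℝ) ^ k * A ^ i * ((i + j).choose i : ℝ) ^ 2 * 2 ^ (i + j)
          ≤ (1 / 2) ^ k * A ^ i * (2 ^ (i + j)) ^ 2 * 2 ^ (i + j) := by gcongr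
        _ = (1 / 2) ^ k * A ^ i * ((2 ^ (i + j)) ^ 2 * 2 ^ (i + j)) := by ring
        _ = (1 / 2) ^ k * A ^ i * (8 ^ i * 8 ^ j) := by
            rw [← pow_succ, ← pow_mul, pow_mul', ← pow_add]
            norm_num
        _ = _ := by ring
    · intro j
      have h0 : S 0 = 1 := rfl
      simp only [structConst_eq_coord, h0, one_mul, S.coord_apply_self]
      by_cases hjk : j = k
      · subst hjk
        simp
      · simp [hjk]
  have hA0 : 0 < A := by linarith
  -- This makes both ratios `8 A ‖x₁‖` and `8 ‖x₂‖` at most `1 / 2`.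
  refine ⟨1 / (16 * A), by positivity, fun x₁ x₂ y hx₁ hx₂ hy => ?_⟩
  have hg : Summable fun n : ℕ => (1 / 2 : ℝ) ^ n := summable_geometric_two
  have hgg := hg.mul_of_nonneg (hg.mul_of_nonneg hg (fun _ => by positivity)
    fun _ => by positivity) (fun _ => by positivity) fun _ => by positivity
  refine Summable.of_norm_bounded hgg ?_
  rintro ⟨i, j, k⟩
  have e1 : 8 * A * ‖x₁‖ ≤ 1 / 2 := by
    rw [lt_div_iff₀ (by positivity)] at hx₁
    linarith
  have e2 : 8 * ‖x₂‖ ≤ 1 / 2 := by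
    rw [lt_div_iff₀ (by positivity)] at hx₂
    nlinarith [norm_nonneg x₂]
  simp only [norm_div, norm_mul, norm_pow]
  calc ‖structConst S i j k‖ * ‖x₁‖ ^ i * ‖x₂‖ ^ j / ‖y‖ ^ (k + 1)
      ≤ ‖structConst S i j k‖ * ‖x₁‖ ^ i * ‖x₂‖ ^ j :=
        div_le_self (by positivity) (one_le_pow₀ hy)
    _ ≤ (1 / 2) ^ k * (8 * A) ^ i * 8 ^ j * ‖x₁‖ ^ i * ‖x₂‖ ^ j := by
        gcongr
        exact hC i j k
    _ = (8 * A * ‖x₁‖) ^ i * ((8 * ‖x₂‖) ^ j * (1 / 2) ^ k) := by ring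
    _ ≤ _ := by gcongr

end Kernel

/-! ### Algebraic identities behind the symmetry of the Heun operator -/

section KernelAlgebra

/-- `t² y²` times the discriminant `heunDisc`; a symmetric polynomial in `x`, `v`, `y`. -/
def discPoly (t y x v : ℂ) : ℂ :=
  (x * v * y - t * (x + v + y)) ^ 2 - 4 * t ^ 2 * (x * v + x * y + v * y)
    + 4 * t * (t + 1) * (x * v * y)

/-- The derivative of `discPoly` in `x`. -/
def discPolyDeriv (t y x v : ℂ) : ℂ :=
  2 * (x * v * y - t * (x + v + y)) * (v * y - t) - 4 * t ^ 2 * (v + y) + 4 * t * (t + 1) * (v * y)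

theorem discPoly_comm (t y x v : ℂ) : discPoly t y x v = discPoly t y v x := by
  unfold discPoly; ring

/-- The polynomial `B` in the logarithmic derivative `(1 + B / w) / (2 (1 - x))` of `heunBase₂`. -/
def logNum₂ (t y x v : ℂ) : ℂ := t * (x - v - y) + 2 * v * y - x * v * y

/-- The polynomial `B` in the logarithmic derivative `(1 + B / w) / (2 (t - x))` of `heunBase₃`. -/
def logNum₃ (t y x v : ℂ) : ℂ := t * (x - v - y) + 2 * t * v * y - x * v * y

theorem discPoly_sub_logNum₂ (t y x v : ℂ) :
    discPoly t y x v - logNum₂ t y x v ^ 2 = (1 - x) * (-4 * v * y * (t - v) * (t - y)) := by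
  unfold discPoly logNum₂; ring

/-- Divisibility by `1 - x` is what cancels the apparent pole at `x = 1` in `heunQuot`; the analogue
for `logNum₃` cancels the one at `x = t`. -/
theorem discPoly_sub_logNum₃ (t y x v : ℂ) :
    discPoly t y x v - logNum₃ t y x v ^ 2 = (t - x) * (-4 * t * v * y * (1 - v) * (1 - y)) := by
  unfold discPoly logNum₃; ring

/-- The logarithmic derivative of the kernel in `x`, where `w² = discPoly`. -/
def logDeriv₁ (t a b y x v w : ℂ) : ℂ :=
  a * ((1 + logNum₂ t y x v / w) / (2 * (1 - x))) + b * ((1 + logNum₃ t y x v / w) / (2 * (t - x)))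
    - discPolyDeriv t y x v / (2 * w ^ 2)

/-- The derivative of `logDeriv₁` in `x`. -/
def logDeriv₂ (t a b y x v w : ℂ) : ℂ :=
  a * (((t - v * y) / w - logNum₂ t y x v * discPolyDeriv t y x v / (2 * w ^ 3)) / (2 * (1 - x))
      + (1 + logNum₂ t y x v / w) / (2 * (1 - x) ^ 2))
    + b * (((t - v * y) / w - logNum₃ t y x v * discPolyDeriv t y x v / (2 * w ^ 3)) / (2 * (t - x))
      + (1 + logNum₃ t y x v / w) / (2 * (t - x) ^ 2))
    - ((v * y - t) ^ 2 / w ^ 2 - discPolyDeriv t y x v ^ 2 / (2 * w ^ 4))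

/-- `(D - l) K / K`, where `D` is the Heun operator in `x` and `K` is the kernel. -/
def heunQuot (t a b y x v w : ℂ) : ℂ :=
  x * (x - 1) * (x - t) * (logDeriv₁ t a b y x v w ^ 2 + logDeriv₂ t a b y x v w)
    + ((x - 1) * (x - t) + (a + 1) * (x * (x - t)) + (b + 1) * (x * (x - 1)))
      * logDeriv₁ t a b y x v w
    + (a + b + 1) * x

/-- Clears all denominators and sorts the quotient by monomials in `a` and `b`, using about `B` and
`B'` only the divisibility relations. Keeping the polynomials abstract keeps the computation small.
-/
theorem heunQuot_aux {t a b x w B B' R R' β D E : ℂ} (hw : w ≠ 0) (hx : 1 - x ≠ 0) (htx : t - x ≠ 0)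
    (h : w ^ 2 - B ^ 2 = (1 - x) * R) (h' : w ^ 2 - B' ^ 2 = (t - x) * R')
    {g g' : ℂ}
    (hg : g = a * ((1 + B / w) / (2 * (1 - x))) + b * ((1 + B' / w) / (2 * (t - x)))
      - D / (2 * w ^ 2))
    (hg' : g' = a * ((β / w - B * D / (2 * w ^ 3)) / (2 * (1 - x))
      + (1 + B / w) / (2 * (1 - x) ^ 2))
      + b * ((β / w - B' * D / (2 * w ^ 3)) / (2 * (t - x)) + (1 + B' / w) / (2 * (t - x) ^ 2))
      - (E / w ^ 2 - D ^ 2 / (2 * w ^ 4))) :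
    4 * w ^ 4 * (x * (x - 1) * (x - t) * (g ^ 2 + g')
      + ((x - 1) * (x - t) + (a + 1) * (x * (x - t)) + (b + 1) * (x * (x - 1))) * g
      + (a + b + 1) * x) =
    -a ^ 2 * (x * (t - x) * R) * w ^ 2 - b ^ 2 * (x * (1 - x) * R') * w ^ 2
      + 2 * a * b * (x * (B * B' - w ^ 2)) * w ^ 2
      + a * (2 * t * w ^ 4
        + w * (2 * w ^ 2 * ((t - 2 * x) * B + x * (t - x) * β) - 3 * x * (t - x) * B * D))
      + b * (2 * w ^ 4
        + w * (2 * w ^ 2 * ((1 - 2 * x) * B' + x * (1 - x) * β) - 3 * x * (1 - x) * B' * D))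
      + (x * (1 - x) * (t - x) * (3 * D ^ 2 - 4 * E * w ^ 2)
        - 2 * (t - 2 * (1 + t) * x + 3 * x ^ 2) * D * w ^ 2 + 4 * x * w ^ 4) := by
  obtain ⟨c, hc⟩ : ∃ c, c = (1 - x)⁻¹ := ⟨_, rfl⟩
  obtain ⟨d, hd⟩ : ∃ d, d = (t - x)⁻¹ := ⟨_, rfl⟩
  have hR : R = c * (w ^ 2 - B ^ 2) := by rw [hc, h]; field_simp
  have hR' : R' = d * (w ^ 2 - B' ^ 2) := by rw [hd, h']; field_simp
  rw [hg, hg', hR, hR', hc, hd]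
  field_simp
  ring

/-- The coefficient of each monomial in `a`, `b` is separately symmetric. For `a²` and `b²` this is
visible from the factored cofactors of `1 - x` and `t - x`; the coefficients of `ab`, `a`, `b` and
`1` need the identities `hab`, `ha`, `hb` and `h0`. -/
theorem heunQuot_symm {t a b y x v w : ℂ} (hw : w ≠ 0) (hx : 1 - x ≠ 0) (htx : t - x ≠ 0)
    (hv : 1 - v ≠ 0) (htv : t - v ≠ 0) (hW : w ^ 2 = discPoly t y x v) :
    heunQuot t a b y x v w = heunQuot t a b y v x w := by
  have hW' : w ^ 2 = discPoly t y v x := hW.trans (discPoly_comm t y x v)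
  have e1 := heunQuot_aux (a := a) (b := b) (β := t - v * y) (D := discPolyDeriv t y x v)
    (E := (v * y - t) ^ 2) hw hx htx (hW ▸ discPoly_sub_logNum₂ t y x v)
    (hW ▸ discPoly_sub_logNum₃ t y x v) (g := logDeriv₁ t a b y x v w)
    (g' := logDeriv₂ t a b y x v w) rfl rfl
  have e2 := heunQuot_aux (a := a) (b := b) (β := t - x * y) (D := discPolyDeriv t y v x)
    (E := (x * y - t) ^ 2) hw hv htv (hW' ▸ discPoly_sub_logNum₂ t y v x)
    (hW' ▸ discPoly_sub_logNum₃ t y v x) (g := logDeriv₁ t a b y v x w)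
    (g' := logDeriv₂ t a b y v x w) rfl rfl
  refine mul_left_cancel₀ (mul_ne_zero (by norm_num : (4 : ℂ) ≠ 0) (pow_ne_zero 4 hw)) ?_
  unfold heunQuot
  rw [e1, e2]
  have hab : x * (logNum₂ t y x v * logNum₃ t y x v - discPoly t y x v) =
      v * (logNum₂ t y v x * logNum₃ t y v x - discPoly t y v x) := by
    unfold logNum₂ logNum₃ discPoly; ring
  have ha : 2 * discPoly t y x v * ((t - 2 * x) * logNum₂ t y x v + x * (t - x) * (t - v * y))
        - 3 * x * (t - x) * logNum₂ t y x v * discPolyDeriv t y x v =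
      2 * discPoly t y v x * ((t - 2 * v) * logNum₂ t y v x + v * (t - v) * (t - x * y))
        - 3 * v * (t - v) * logNum₂ t y v x * discPolyDeriv t y v x := by
    unfold logNum₂ discPoly discPolyDeriv; ring
  have hb : 2 * discPoly t y x v * ((1 - 2 * x) * logNum₃ t y x v + x * (1 - x) * (t - v * y))
        - 3 * x * (1 - x) * logNum₃ t y x v * discPolyDeriv t y x v =
      2 * discPoly t y v x * ((1 - 2 * v) * logNum₃ t y v x + v * (1 - v) * (t - x * y))
        - 3 * v * (1 - v) * logNum₃ t y v x * discPolyDeriv t y v x := by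
    unfold logNum₃ discPoly discPolyDeriv; ring
  have h0 : x * (1 - x) * (t - x)
          * (3 * discPolyDeriv t y x v ^ 2 - 4 * (v * y - t) ^ 2 * discPoly t y x v)
        - 2 * (t - 2 * (1 + t) * x + 3 * x ^ 2) * discPolyDeriv t y x v * discPoly t y x v
        + 4 * x * discPoly t y x v ^ 2 =
      v * (1 - v) * (t - v)
          * (3 * discPolyDeriv t y v x ^ 2 - 4 * (x * y - t) ^ 2 * discPoly t y v x)
        - 2 * (t - 2 * (1 + t) * v + 3 * v ^ 2) * discPolyDeriv t y v x * discPoly t y v x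
        + 4 * v * discPoly t y v x ^ 2 := by
    unfold discPoly discPolyDeriv; ring
  rw [← hW, ← hW'] at hab ha hb h0
  linear_combination 2 * a * b * w ^ 2 * hab + a * w * ha + b * w * hb + h0

end KernelAlgebra

/-! ### The closed form and its logarithmic derivatives -/

section KernelFunction

/-- The base of the power `s₂ - 1` in the kernel. -/
def heunBase₂ (t y x v : ℂ) : ℂ :=
  (2 * t - t * (x + v + y) + x * v * y + t * y * heunDisc t x v y ^ (1 / 2 : ℂ))
    / (2 * t * (1 - x) * (1 - v))

/-- The base of the power `s₃ - 1` in the kernel. -/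
def heunBase₃ (t y x v : ℂ) : ℂ :=
  (2 * t ^ 2 - t * (x + v + y) + x * v * y + t * y * heunDisc t x v y ^ (1 / 2 : ℂ))
    / (2 * (t - x) * (t - v))

/-- The closed form of the kernel, with `a = s₂ - 1` and `b = s₃ - 1`. -/
def heunKernel (t a b y : ℂ) (p : ℂ × ℂ) : ℂ :=
  heunBase₂ t y p.1 p.2 ^ a * heunBase₃ t y p.1 p.2 ^ b
    * (1 / (y * heunDisc t p.1 p.2 y ^ (1 / 2 : ℂ)))

/-- The points at which the principal powers in the kernel are holomorphic. -/
def KernelRegular (t y x v : ℂ) : Prop :=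
  heunDisc t x v y ∈ Complex.slitPlane ∧ heunBase₂ t y x v ∈ Complex.slitPlane ∧
    heunBase₃ t y x v ∈ Complex.slitPlane

theorem heunDisc_comm (t x v y : ℂ) : heunDisc t x v y = heunDisc t v x y := by
  unfold heunDisc; ring

theorem heunBase₂_comm (t y x v : ℂ) : heunBase₂ t y x v = heunBase₂ t y v x := by
  unfold heunBase₂; rw [heunDisc_comm]; ring

theorem heunBase₃_comm (t y x v : ℂ) : heunBase₃ t y x v = heunBase₃ t y v x := by
  unfold heunBase₃; rw [heunDisc_comm]; ring

theorem heunKernel_swap (t a b y : ℂ) (p : ℂ × ℂ) :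
    heunKernel t a b y p.swap = heunKernel t a b y p := by
  unfold heunKernel
  rw [Prod.fst_swap, Prod.snd_swap, heunBase₂_comm, heunBase₃_comm, heunDisc_comm]

theorem KernelRegular.symm {t y x v : ℂ} (h : KernelRegular t y x v) : KernelRegular t y v x := by
  unfold KernelRegular at *
  rwa [heunBase₂_comm, heunBase₃_comm, heunDisc_comm]

variable {t y : ℂ}

theorem KernelRegular.ne_zero {x v : ℂ} (h : KernelRegular t y x v) :
    1 - x ≠ 0 ∧ 1 - v ≠ 0 ∧ t - x ≠ 0 ∧ t - v ≠ 0 := by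
  have h2 := Complex.slitPlane_ne_zero h.2.1
  have h3 := Complex.slitPlane_ne_zero h.2.2
  rw [heunBase₂] at h2
  rw [heunBase₃] at h3
  have h2 := (div_ne_zero_iff.mp h2).2
  have h3 := (div_ne_zero_iff.mp h3).2
  simp only [mul_ne_zero_iff] at h2 h3
  exact ⟨h2.1.2, h2.2, h3.1.2, h3.2⟩

theorem heunDisc_eq (ht : t ≠ 0) (hy : y ≠ 0) (x v : ℂ) :
    heunDisc t x v y = discPoly t y x v / (t ^ 2 * y ^ 2) := by
  unfold heunDisc discPoly
  field_simp
  ring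

theorem sq_root_heunDisc (ht : t ≠ 0) (hy : y ≠ 0) (x v : ℂ) :
    (t * y * heunDisc t x v y ^ (1 / 2 : ℂ)) ^ 2 = discPoly t y x v := by
  have : (heunDisc t x v y ^ (1 / 2 : ℂ)) ^ 2 = heunDisc t x v y := by
    simp
  rw [mul_pow, this, heunDisc_eq ht hy]
  field_simp

theorem root_heunDisc_ne_zero (ht : t ≠ 0) (hy : y ≠ 0) {x v : ℂ} (h : KernelRegular t y x v) :
    t * y * heunDisc t x v y ^ (1 / 2 : ℂ) ≠ 0 := by
  have := Complex.slitPlane_ne_zero h.1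
  have : heunDisc t x v y ^ (1 / 2 : ℂ) ≠ 0 := by simp [Complex.cpow_eq_zero_iff, this]
  exact mul_ne_zero (mul_ne_zero ht hy) this

theorem hasDerivAt_discPoly (x v : ℂ) :
    HasDerivAt (fun s => discPoly t y s v) (discPolyDeriv t y x v) x := by
  -- `discPoly` is quadratic in each variable.
  have e : (fun s => discPoly t y s v) = fun s => discPoly t y 0 v
      + (discPolyDeriv t y 0 v) * s + (v * y - t) ^ 2 * s ^ 2 := by
    funext s
    unfold discPoly discPolyDeriv
    ring
  rw [e]
  refine ((((hasDerivAt_id' x).const_mul (discPolyDeriv t y 0 v)).const_add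
    (discPoly t y 0 v)).fun_add ((hasDerivAt_pow 2 x).const_mul ((v * y - t) ^ 2))).congr_deriv ?_
  unfold discPolyDeriv
  push_cast
  ring

theorem hasDerivAt_root_heunDisc (ht : t ≠ 0) (hy : y ≠ 0) {x v : ℂ} (h : KernelRegular t y x v) :
    HasDerivAt (fun s => t * y * heunDisc t s v y ^ (1 / 2 : ℂ))
      (discPolyDeriv t y x v / (2 * (t * y * heunDisc t x v y ^ (1 / 2 : ℂ)))) x := by
  have hd : HasDerivAt (fun s => heunDisc t s v y) (discPolyDeriv t y x v / (t ^ 2 * y ^ 2)) x := by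
    simp only [heunDisc_eq ht hy]
    exact (hasDerivAt_discPoly x v).div_const _
  have hne := Complex.slitPlane_ne_zero h.1
  have hr : heunDisc t x v y ^ (1 / 2 : ℂ) ≠ 0 := by simp [Complex.cpow_eq_zero_iff, hne]
  have hsq : (heunDisc t x v y ^ (1 / 2 : ℂ)) ^ 2 = heunDisc t x v y := by
    simp
  refine ((hd.cpow_const (c := 1 / 2) h.1).const_mul (t * y)).congr_deriv ?_
  have e : heunDisc t x v y ^ (1 / 2 - 1 : ℂ) = (heunDisc t x v y ^ (1 / 2 : ℂ))⁻¹ := by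
    rw [Complex.cpow_sub _ _ hne, Complex.cpow_one, div_eq_iff hne]
    field_simp
    exact hsq
  rw [e]
  field_simp

/-- Once denominators are cleared in the quotient rule, the claim is exactly the relation `w ^ 2 =
discPoly t y x v`; `logNum₂` is the polynomial that makes this so. -/
theorem hasDerivAt_heunBase₂ (ht : t ≠ 0) (hy : y ≠ 0) {x v w : ℂ} (h : KernelRegular t y x v)
    (hw : w = t * y * heunDisc t x v y ^ (1 / 2 : ℂ)) :
    HasDerivAt (fun s => heunBase₂ t y s v)
      (heunBase₂ t y x v * ((1 + logNum₂ t y x v / w) / (2 * (1 - x)))) x := by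
  obtain ⟨h1, h2, h3, h4⟩ := h.ne_zero
  have hw0 : w ≠ 0 := hw ▸ root_heunDisc_ne_zero ht hy h
  have hW : w ^ 2 = discPoly t y x v := hw ▸ sq_root_heunDisc ht hy x v
  have hr := hasDerivAt_root_heunDisc ht hy h
  have hid := hasDerivAt_id' x
  have hN : HasDerivAt (fun s => 2 * t - t * (s + v + y) + s * v * y
      + t * y * heunDisc t s v y ^ (1 / 2 : ℂ)) (-t + v * y + discPolyDeriv t y x v / (2 * w)) x := by
    rw [hw]
    refine HasDerivAt.fun_add ?_ hr
    refine (((((hid.add_const v).add_const y).const_mul t).const_sub (2 * t)).fun_add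
      ((hid.mul_const v).mul_const y)).congr_deriv ?_
    ring
  have hD : HasDerivAt (fun s => 2 * t * (1 - s) * (1 - v)) (2 * t * (-1) * (1 - v)) x :=
    ((hid.const_sub 1).const_mul (2 * t)).mul_const (1 - v)
  have hD0 : 2 * t * (1 - x) * (1 - v) ≠ 0 := by simp [ht, h1, h2]
  refine (hN.fun_div hD hD0).congr_deriv ?_
  rw [heunBase₂, ← hw]
  field_simp
  unfold discPoly at hW
  unfold logNum₂ discPolyDeriv
  linear_combination hW

theorem hasDerivAt_heunBase₃ (ht : t ≠ 0) (hy : y ≠ 0) {x v w : ℂ} (h : KernelRegular t y x v)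
    (hw : w = t * y * heunDisc t x v y ^ (1 / 2 : ℂ)) :
    HasDerivAt (fun s => heunBase₃ t y s v)
      (heunBase₃ t y x v * ((1 + logNum₃ t y x v / w) / (2 * (t - x)))) x := by
  obtain ⟨h1, h2, h3, h4⟩ := h.ne_zero
  have hw0 : w ≠ 0 := hw ▸ root_heunDisc_ne_zero ht hy h
  have hW : w ^ 2 = discPoly t y x v := hw ▸ sq_root_heunDisc ht hy x v
  have hr := hasDerivAt_root_heunDisc ht hy h
  have hid := hasDerivAt_id' x
  have hN : HasDerivAt (fun s => 2 * t ^ 2 - t * (s + v + y) + s * v * y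
      + t * y * heunDisc t s v y ^ (1 / 2 : ℂ)) (-t + v * y + discPolyDeriv t y x v / (2 * w)) x := by
    rw [hw]
    refine HasDerivAt.fun_add ?_ hr
    refine (((((hid.add_const v).add_const y).const_mul t).const_sub (2 * t ^ 2)).fun_add
      ((hid.mul_const v).mul_const y)).congr_deriv ?_
    ring
  have hD : HasDerivAt (fun s => 2 * (t - s) * (t - v)) (2 * (-1) * (t - v)) x :=
    ((hid.const_sub t).const_mul 2).mul_const (t - v)
  have hD0 : 2 * (t - x) * (t - v) ≠ 0 := by simp [h3, h4]
  refine (hN.fun_div hD hD0).congr_deriv ?_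
  rw [heunBase₃, ← hw]
  field_simp
  unfold discPoly at hW
  unfold logNum₃ discPolyDeriv
  linear_combination hW

theorem hasDerivAt_heunKernel (ht : t ≠ 0) (hy : y ≠ 0) (a b : ℂ) {x v w : ℂ}
    (h : KernelRegular t y x v) (hw : w = t * y * heunDisc t x v y ^ (1 / 2 : ℂ)) :
    HasDerivAt (fun s => heunKernel t a b y (s, v))
      (heunKernel t a b y (x, v) * logDeriv₁ t a b y x v w) x := by
  have hw0 : w ≠ 0 := hw ▸ root_heunDisc_ne_zero ht hy h
  have h2 := (hasDerivAt_heunBase₂ ht hy h hw).cpow_const (c := a) h.2.1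
  have h3 := (hasDerivAt_heunBase₃ ht hy h hw).cpow_const (c := b) h.2.2
  have hr := hasDerivAt_root_heunDisc ht hy h
  rw [← hw] at hr
  have hi := ((hr.fun_inv (hw ▸ hw0)).const_mul t)
  have hn2 := Complex.slitPlane_ne_zero h.2.1
  have hn3 := Complex.slitPlane_ne_zero h.2.2
  -- The last factor of the kernel is `t / w`, so one root `w` carries all the differentiation.
  have e (s : ℂ) : 1 / (y * heunDisc t s v y ^ (1 / 2 : ℂ)) =
      t * (t * y * heunDisc t s v y ^ (1 / 2 : ℂ))⁻¹ := by
    rw [mul_assoc t, mul_inv t, mul_inv_cancel_left₀ ht, one_div]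
  simp only [heunKernel, e]
  refine ((h2.fun_mul h3).fun_mul hi).congr_deriv ?_
  rw [← hw, Complex.cpow_sub _ _ hn2, Complex.cpow_sub _ _ hn3, Complex.cpow_one, Complex.cpow_one,
    logDeriv₁]
  field_simp
  ring

theorem hasDerivAt_logDeriv₁ (ht : t ≠ 0) (hy : y ≠ 0) (a b : ℂ) {x v w : ℂ}
    (h : KernelRegular t y x v) (hw : w = t * y * heunDisc t x v y ^ (1 / 2 : ℂ)) :
    HasDerivAt (fun s => logDeriv₁ t a b y s v (t * y * heunDisc t s v y ^ (1 / 2 : ℂ)))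
      (logDeriv₂ t a b y x v w) x := by
  obtain ⟨h1, h2, h3, h4⟩ := h.ne_zero
  have hw0 : w ≠ 0 := hw ▸ root_heunDisc_ne_zero ht hy h
  have hr := hasDerivAt_root_heunDisc ht hy h
  have hid := hasDerivAt_id' x
  rw [← hw] at hr
  have hlin (f : ℂ → ℂ) (c d : ℂ) (hf : ∀ s, f s = c * s + d) : HasDerivAt f c x := by
    rw [funext hf]
    simpa using (hid.const_mul c).add_const d
  have hN2 : HasDerivAt (fun s => logNum₂ t y s v) (t - v * y) x :=
    hlin _ _ (logNum₂ t y 0 v) fun s => by unfold logNum₂; ring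
  have hN3 : HasDerivAt (fun s => logNum₃ t y s v) (t - v * y) x :=
    hlin _ _ (logNum₃ t y 0 v) fun s => by unfold logNum₃; ring
  have hE : HasDerivAt (fun s => discPolyDeriv t y s v) (2 * (v * y - t) ^ 2) x :=
    hlin _ _ (discPolyDeriv t y 0 v) fun s => by unfold discPolyDeriv; ring
  have hw1 : t * y * heunDisc t x v y ^ (1 / 2 : ℂ) ≠ 0 := hw ▸ hw0
  have k2 := (((hN2.fun_div hr hw1).const_add 1).fun_div ((hid.const_sub 1).const_mul 2)
    (mul_ne_zero two_ne_zero h1)).const_mul a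
  have k3 := (((hN3.fun_div hr hw1).const_add 1).fun_div ((hid.const_sub t).const_mul 2)
    (mul_ne_zero two_ne_zero h3)).const_mul b
  have k4 := hE.fun_div ((hr.fun_pow 2).const_mul 2) (mul_ne_zero two_ne_zero (pow_ne_zero 2 hw1))
  refine ((k2.fun_add k3).fun_sub k4).congr_deriv ?_
  rw [← hw, logDeriv₂]
  push_cast
  field_simp
  ring

end KernelFunction

/-! ### The differential equation, and the recurrence for Taylor coefficients -/

section KernelTaylor

attribute [local fun_prop] analyticAt_fst analyticAt_snd

theorem dirDeriv_fst_eq {F : ℂ × ℂ → ℂ} {x v c : ℂ} (hF : DifferentiableAt ℂ F (x, v))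
    (h : HasDerivAt (fun s => F (s, v)) c x) : dirDeriv (1, 0) F (x, v) = c := by
  have h1 : HasDerivAt (fun s : ℂ => (s, v)) ((1 : ℂ), (0 : ℂ)) x :=
    (hasDerivAt_id' x).prodMk (hasDerivAt_const x v)
  exact (hF.hasFDerivAt.comp_hasDerivAt x h1).unique h

theorem dirDeriv_snd_eq_comp_swap (F : ℂ × ℂ → ℂ) :
    dirDeriv (0, 1) F = dirDeriv (1, 0) (F ∘ Prod.swap) ∘ Prod.swap := by
  ext p
  have := (ContinuousLinearEquiv.prodComm ℂ ℂ ℂ).comp_right_fderiv (f := F) (x := p.swap)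
  have e : ⇑(ContinuousLinearEquiv.prodComm ℂ ℂ ℂ) = Prod.swap := rfl
  rw [e, Prod.swap_swap] at this
  simp [dirDeriv, this]

variable {t y : ℂ}

theorem KernelRegular.analyticAt_heunDisc (ht : t ≠ 0) (hy : y ≠ 0) (p : ℂ × ℂ) :
    AnalyticAt ℂ (fun q : ℂ × ℂ => heunDisc t q.1 q.2 y) p := by
  simp only [heunDisc_eq ht hy]
  refine AnalyticAt.div_const ?_
  unfold discPoly
  fun_prop

theorem KernelRegular.analyticAt_heunBase₂ (ht : t ≠ 0) (hy : y ≠ 0) {p : ℂ × ℂ}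
    (h : heunDisc t p.1 p.2 y ∈ Complex.slitPlane) (h1 : 1 - p.1 ≠ 0) (h2 : 1 - p.2 ≠ 0) :
    AnalyticAt ℂ (fun q : ℂ × ℂ => heunBase₂ t y q.1 q.2) p := by
  have hr := (analyticAt_heunDisc ht hy p).cpow (g := fun _ => 1 / 2) analyticAt_const h
  unfold heunBase₂
  refine AnalyticAt.fun_div ?_ (by fun_prop) (by simp [ht, h1, h2])
  exact AnalyticAt.fun_add (by fun_prop) (analyticAt_const.fun_mul hr)

theorem KernelRegular.analyticAt_heunBase₃ (ht : t ≠ 0) (hy : y ≠ 0) {p : ℂ × ℂ}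
    (h : heunDisc t p.1 p.2 y ∈ Complex.slitPlane) (h1 : t - p.1 ≠ 0) (h2 : t - p.2 ≠ 0) :
    AnalyticAt ℂ (fun q : ℂ × ℂ => heunBase₃ t y q.1 q.2) p := by
  have hr := (analyticAt_heunDisc ht hy p).cpow (g := fun _ => 1 / 2) analyticAt_const h
  unfold heunBase₃
  refine AnalyticAt.fun_div ?_ (by fun_prop) (by simp [h1, h2])
  exact AnalyticAt.fun_add (by fun_prop) (analyticAt_const.fun_mul hr)

theorem KernelRegular.eventually (ht : t ≠ 0) (hy : y ≠ 0) {p : ℂ × ℂ}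
    (h : KernelRegular t y p.1 p.2) : ∀ᶠ q : ℂ × ℂ in 𝓝 p, KernelRegular t y q.1 q.2 := by
  obtain ⟨h1, h2, h3, h4⟩ := h.ne_zero
  have ho := Complex.isOpen_slitPlane
  exact ((analyticAt_heunDisc ht hy p).continuousAt.eventually (ho.mem_nhds h.1)).and
    (((analyticAt_heunBase₂ ht hy h.1 h1 h2).continuousAt.eventually (ho.mem_nhds h.2.1)).and
    ((analyticAt_heunBase₃ ht hy h.1 h3 h4).continuousAt.eventually (ho.mem_nhds h.2.2)))

theorem KernelRegular.analyticAt_heunKernel (ht : t ≠ 0) (hy : y ≠ 0) (a b : ℂ) {p : ℂ × ℂ}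
    (h : KernelRegular t y p.1 p.2) : AnalyticAt ℂ (heunKernel t a b y) p := by
  obtain ⟨h1, h2, h3, h4⟩ := h.ne_zero
  have hr := (analyticAt_heunDisc ht hy p).cpow (g := fun _ => 1 / 2) analyticAt_const h.1
  have hn : heunDisc t p.1 p.2 y ^ (1 / 2 : ℂ) ≠ 0 := by
    simp [Complex.cpow_eq_zero_iff, Complex.slitPlane_ne_zero h.1]
  have k2 := (analyticAt_heunBase₂ ht hy h.1 h1 h2).cpow (g := fun _ => a) analyticAt_const h.2.1
  have k3 := (analyticAt_heunBase₃ ht hy h.1 h3 h4).cpow (g := fun _ => b) analyticAt_const h.2.2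
  exact (k2.fun_mul k3).fun_mul
    (analyticAt_const.fun_div (analyticAt_const.fun_mul hr) (mul_ne_zero hy hn))

/-- The part `D - l` of the Heun operator (with `s₁ = r₁ = 1`) that does not involve the accessory
parameter, for functions on `ℂ × ℂ`; `X` is a coordinate and `v` the direction of that
coordinate. -/
def heunPart (t s₂ s₃ r₂ : ℂ) (X : ℂ × ℂ → ℂ) (v : ℂ × ℂ) (F : ℂ × ℂ → ℂ) : ℂ × ℂ → ℂ := fun p =>
  X p * (X p - 1) * (X p - t) * dirDeriv v (dirDeriv v F) p
    + ((X p - 1) * (X p - t) + s₂ * (X p * (X p - t)) + s₃ * (X p * (X p - 1))) * dirDeriv v F p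
    + r₂ * X p * F p

/-- With `g` the logarithmic derivative of `K`, one has `K' = K g` and `K'' = K (g² + g')`, so the
operator only multiplies `K` by `heunQuot`. -/
theorem KernelRegular.heunPart_fst (ht : t ≠ 0) (hy : y ≠ 0) (a b : ℂ) {x v w : ℂ}
    (h : KernelRegular t y x v) (hw : w = t * y * heunDisc t x v y ^ (1 / 2 : ℂ)) :
    heunPart t (a + 1) (b + 1) (a + b + 1) Prod.fst (1, 0) (heunKernel t a b y) (x, v) =
      heunKernel t a b y (x, v) * heunQuot t a b y x v w := by
  have hA := analyticAt_heunKernel ht hy a b (p := (x, v)) h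
  have hd (x' v' : ℂ) (hq : KernelRegular t y x' v') :
      dirDeriv (1, 0) (heunKernel t a b y) (x', v') = heunKernel t a b y (x', v') *
        logDeriv₁ t a b y x' v' (t * y * heunDisc t x' v' y ^ (1 / 2 : ℂ)) :=
    dirDeriv_fst_eq (analyticAt_heunKernel ht hy a b (p := (x', v')) hq).differentiableAt
      (hasDerivAt_heunKernel ht hy a b hq rfl)
  -- A second differentiation needs the formula for the first derivative on a neighbourhood of `x`.
  have hline : ∀ᶠ s in 𝓝 x, KernelRegular t y s v :=
    ((Continuous.prodMk_left v).tendsto x).eventually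
      (KernelRegular.eventually ht hy (p := (x, v)) h)
  have hdd : dirDeriv (1, 0) (dirDeriv (1, 0) (heunKernel t a b y)) (x, v) =
      heunKernel t a b y (x, v) * (logDeriv₁ t a b y x v w ^ 2 + logDeriv₂ t a b y x v w) := by
    refine dirDeriv_fst_eq hA.dirDeriv.differentiableAt ?_
    have h1 := (hasDerivAt_heunKernel ht hy a b h hw).fun_mul
      (hasDerivAt_logDeriv₁ ht hy a b h hw)
    refine HasDerivAt.congr_of_eventuallyEq ?_ (hline.mono fun s hs => hd s v hs)
    refine h1.congr_deriv ?_
    rw [← hw]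
    ring
  simp only [heunPart]
  rw [hdd, hd x v h, heunQuot, ← hw]
  ring

/-- Symmetry of `F` reduces the second variable to the first, so all derivatives of the kernel are
computed in `x₁` only. -/
theorem heunPart_snd_eq_comp_swap {s₂ s₃ r₂ : ℂ} {F : ℂ × ℂ → ℂ} (hF : F ∘ Prod.swap = F) :
    heunPart t s₂ s₃ r₂ Prod.snd (0, 1) F =
      heunPart t s₂ s₃ r₂ Prod.fst (1, 0) F ∘ Prod.swap := by
  have h1 : dirDeriv (0, 1) F = dirDeriv (1, 0) F ∘ Prod.swap := by
    rw [dirDeriv_snd_eq_comp_swap, hF]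
  have h2 : dirDeriv (0, 1) (dirDeriv (0, 1) F) =
      dirDeriv (1, 0) (dirDeriv (1, 0) F) ∘ Prod.swap := by
    rw [dirDeriv_snd_eq_comp_swap, h1, Function.comp_assoc]
    simp
  ext p
  have hp : F p.swap = F p := congrFun hF p
  simp only [heunPart, h2, Function.comp_apply]
  rw [h1, Function.comp_apply, hp]
  simp only [Prod.fst_swap]

/-- The kernel satisfies the same Heun equation in both variables. -/
theorem KernelRegular.heunPart_fst_eq_snd (ht : t ≠ 0) (hy : y ≠ 0) (a b : ℂ) {p : ℂ × ℂ}
    (h : KernelRegular t y p.1 p.2) :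
    heunPart t (a + 1) (b + 1) (a + b + 1) Prod.fst (1, 0) (heunKernel t a b y) p =
      heunPart t (a + 1) (b + 1) (a + b + 1) Prod.snd (0, 1) (heunKernel t a b y) p := by
  obtain ⟨h1, h2, h3, h4⟩ := h.ne_zero
  rw [heunPart_snd_eq_comp_swap (F := heunKernel t a b y) (_root_.funext (heunKernel_swap t a b y)),
    Function.comp_apply]
  have e1 := h.heunPart_fst ht hy a b rfl
  have e2 := h.symm.heunPart_fst ht hy a b rfl
  rw [heunDisc_comm t p.2 p.1] at e2
  have e3 := heunKernel_swap t a b y p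
  refine e1.trans (Eq.trans ?_ e2.symm)
  rw [heunQuot_symm (root_heunDisc_ne_zero ht hy h) h1 h3 h2 h4 (sq_root_heunDisc ht hy _ _)]
  exact congrArg (· * _) e3.symm

/-- The coefficient formula behind `HeunRec`: `d F n` stands for an `n`-th derivative of `F` at the
origin in the direction `v` of the coordinate `X`. -/
theorem heunPart_coeff {s₂ s₃ r₂ : ℂ} (hr : 1 + r₂ = 1 + s₂ + s₃ - 1) {X : ℂ × ℂ → ℂ} {v : ℂ × ℂ}
    (hX : AnalyticAt ℂ X 0) {d : (ℂ × ℂ → ℂ) → ℕ → ℂ}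
    (hadd : ∀ {F F'}, AnalyticAt ℂ F 0 → AnalyticAt ℂ F' 0 → ∀ n, d (F + F') n = d F n + d F' n)
    (hsmul : ∀ (c : ℂ) F n, d (c • F) n = c * d F n)
    (hmul : ∀ {F}, AnalyticAt ℂ F 0 → ∀ n : ℕ, d (X * F) n = n * d F (n - 1))
    (hder : ∀ {F}, AnalyticAt ℂ F 0 → ∀ n, d (dirDeriv v F) n = d F (n + 1))
    {F : ℂ × ℂ → ℂ} (hF : AnalyticAt ℂ F 0) (n : ℕ) :
    d (heunPart t s₂ s₃ r₂ X v F) n = t * (n + 1) * d F (n + 1)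
      - n * ((1 + t) * n + s₂ * t + s₃) * d F n + n * (n * (n - 1 + r₂)) * d F (n - 1) := by
  have hF1 : AnalyticAt ℂ (dirDeriv v F) 0 := hF.dirDeriv
  have hF2 : AnalyticAt ℂ (dirDeriv v (dirDeriv v F)) 0 := hF1.dirDeriv
  have e : heunPart t s₂ s₃ r₂ X v F =
      X * (X * (X * dirDeriv v (dirDeriv v F)))
      + ((-(1 + t)) • (X * (X * dirDeriv v (dirDeriv v F)))
      + (t • (X * dirDeriv v (dirDeriv v F))
      + ((1 + s₂ + s₃) • (X * (X * dirDeriv v F))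
      + ((-(1 + t + s₂ * t + s₃)) • (X * dirDeriv v F)
      + (t • dirDeriv v F + r₂ • (X * F)))))) := by
    ext p
    simp [heunPart]
    ring
  have a1 : AnalyticAt ℂ (X * dirDeriv v (dirDeriv v F)) 0 := hX.mul hF2
  have a2 : AnalyticAt ℂ (X * (X * dirDeriv v (dirDeriv v F))) 0 := hX.mul a1
  have a3 : AnalyticAt ℂ (X * (X * (X * dirDeriv v (dirDeriv v F)))) 0 := hX.mul a2
  have b1 : AnalyticAt ℂ (X * dirDeriv v F) 0 := hX.mul hF1
  have b2 : AnalyticAt ℂ (X * (X * dirDeriv v F)) 0 := hX.mul b1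
  have c1 : AnalyticAt ℂ (X * F) 0 := hX.mul hF
  have z6 := (hF1.const_smul (c := t)).add (c1.const_smul (c := r₂))
  have z5 := (b1.const_smul (c := -(1 + t + s₂ * t + s₃))).add z6
  have z4 := (b2.const_smul (c := 1 + s₂ + s₃)).add z5
  have z3 := (a1.const_smul (c := t)).add z4
  have z2 := (a2.const_smul (c := -(1 + t))).add z3
  rw [e, hadd a3 z2, hadd a2.const_smul z3, hadd a1.const_smul z4, hadd b2.const_smul z5,
    hadd b1.const_smul z6, hadd hF1.const_smul c1.const_smul]
  simp only [hsmul, hmul a2, hmul a1, hmul hF2, hmul b1, hmul hF1, hmul hF, hder hF1, hder hF]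
  -- This relation makes the coefficient of `d F (n - 1)` factor as `n * (n * (n - 1 + r₂))`. The
  -- cases `n < 3` are separate because the cubic term shifts the index down by three with truncated
  -- subtraction.
  have hr' : r₂ = s₂ + s₃ - 1 := by linear_combination hr
  rcases n with _ | _ | _ | n
  · simp
  · simp [hr']
    ring
  · simp [hr']
    ring
  · simp [hr']
    ring

theorem heunRec_taylorCoeff {s₂ s₃ r₂ : ℂ} (hr : 1 + r₂ = 1 + s₂ + s₃ - 1) {F : ℂ × ℂ → ℂ}
    (hF : AnalyticAt ℂ F 0)
    (h : heunPart t s₂ s₃ r₂ Prod.fst (1, 0) F =ᶠ[𝓝 0] heunPart t s₂ s₃ r₂ Prod.snd (0, 1) F) :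
    HeunRec t s₂ s₃ r₂ (taylorCoeff F) := by
  intro i j
  have e1 := heunPart_coeff (t := t) hr (d := fun F n => mixedDeriv F n j) analyticAt_fst
    (fun h h' n => mixedDeriv_add h h' n j) (fun c F n => mixedDeriv_const_smul c F n j)
    (fun h n => mixedDeriv_fst_mul h n j) (fun h n => mixedDeriv_dirDeriv_fst h n j) hF i
  have e2 := heunPart_coeff (t := t) hr (d := mixedDeriv (i := i)) analyticAt_snd
    (fun h h' n => mixedDeriv_add h h' i n) (fun c F n => mixedDeriv_const_smul c F i n)
    (fun h n => mixedDeriv_snd_mul h i n) (fun {F} h n => mixedDeriv_dirDeriv_snd F i n) hF j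
  rw [mixedDeriv_congr h i j, e2] at e1
  have hfac (n : ℕ) : (n.factorial : ℂ) ≠ 0 := by exact_mod_cast n.factorial_ne_zero
  have up (n : ℕ) : ((n + 1).factorial : ℂ) = (n + 1) * n.factorial := by
    rw [Nat.factorial_succ]; push_cast; rfl
  -- The extra factor `n` on both sides makes this valid at `n = 0`.
  have down (n : ℕ) : (n : ℂ) * (n - 1).factorial * (n : ℂ) = n * n.factorial := by
    rcases n with _ | n
    · simp
    · rw [up, Nat.add_sub_cancel]; push_cast; ring
  have u1 : t * (i + 1) ^ 2 * taylorCoeff F (i + 1) j =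
      t * (i + 1) * mixedDeriv F (i + 1) j / (i.factorial * j.factorial) := by
    have := Nat.cast_add_one_ne_zero (R := ℂ) i
    have := hfac i
    have := hfac j
    rw [taylorCoeff, up]
    field_simp
  have u2 : t * (j + 1) ^ 2 * taylorCoeff F i (j + 1) =
      t * (j + 1) * mixedDeriv F i (j + 1) / (i.factorial * j.factorial) := by
    have := Nat.cast_add_one_ne_zero (R := ℂ) j
    have := hfac i
    have := hfac j
    rw [taylorCoeff, up]
    field_simp
  have w1 : i * (i - 1 + r₂) * taylorCoeff F (i - 1) j =
      i * (i * (i - 1 + r₂)) * mixedDeriv F (i - 1) j / (i.factorial * j.factorial) := by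
    rw [taylorCoeff, ← mul_div_assoc, div_eq_div_iff (mul_ne_zero (hfac _) (hfac _))
      (mul_ne_zero (hfac _) (hfac _))]
    linear_combination (-(i - 1 + r₂) * mixedDeriv F (i - 1) j * j.factorial) * down i
  have w2 : j * (j - 1 + r₂) * taylorCoeff F i (j - 1) =
      j * (j * (j - 1 + r₂)) * mixedDeriv F i (j - 1) / (i.factorial * j.factorial) := by
    rw [taylorCoeff, ← mul_div_assoc, div_eq_div_iff (mul_ne_zero (hfac _) (hfac _))
      (mul_ne_zero (hfac _) (hfac _))]
    linear_combination (-(j - 1 + r₂) * mixedDeriv F i (j - 1) * i.factorial) * down j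
  rw [u1, u2, w1, w2, taylorCoeff]
  linear_combination (-1 / ((i.factorial : ℂ) * j.factorial)) * e1

end KernelTaylor

/-! ### Uniform regularity, the initial row, and identification of coefficients -/

section KernelTheorem

theorem heunDisc_zero (t y : ℂ) : heunDisc t 0 0 y = 1 := by
  simp [heunDisc]

theorem kernelRegular_zero {t : ℂ} (ht : t ≠ 0) (y : ℂ) : KernelRegular t y 0 0 := by
  have h2 : heunBase₂ t y 0 0 = 1 := by
    simp [heunBase₂, heunDisc_zero, ht]
  have h3 : heunBase₃ t y 0 0 = 1 := by
    simp only [heunBase₃, heunDisc_zero, Complex.one_cpow]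
    field_simp
    ring
  simp [KernelRegular, heunDisc_zero, h2, h3]

/-- The cofactor of `1 / y` in the difference of the discriminant and `(1 - x v / t)²`. -/
def discRest (t x v z : ℂ) : ℂ :=
  -2 * x - 2 * v + (x ^ 2 + v ^ 2) * z - 2 * (x ^ 2 * v + x * v ^ 2) / t
    + 2 * (2 * t - t * z + 2) * (x * v) / t

theorem heunDisc_eq_add_discRest {t y : ℂ} (ht : t ≠ 0) (hy : y ≠ 0) (x v : ℂ) :
    heunDisc t x v y = (1 - x * v / t) ^ 2 + y⁻¹ * discRest t x v y⁻¹ := by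
  unfold heunDisc discRest
  field_simp
  ring

/-- With `r = P^(1/2)` and `q = 1 - x v / t`, this is `r - q = (r² - q²) / (r + q)`. The terms `t *
y - x * v * y` cancel the unbounded part of the numerators of both bases, leaving expressions that
stay bounded as `y → ∞`. -/
theorem rationalize_root {t y x v : ℂ} (ht : t ≠ 0) (hy : y ≠ 0)
    (h : heunDisc t x v y ^ (1 / 2 : ℂ) + (1 - x * v / t) ≠ 0) :
    t * y * heunDisc t x v y ^ (1 / 2 : ℂ) = t * y - x * v * y
      + t * discRest t x v y⁻¹ / (heunDisc t x v y ^ (1 / 2 : ℂ) + (1 - x * v / t)) := by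
  have hsq : (heunDisc t x v y ^ (1 / 2 : ℂ)) ^ 2 =
      (1 - x * v / t) ^ 2 + y⁻¹ * discRest t x v y⁻¹ := by
    rw [← heunDisc_eq_add_discRest ht hy]
    simp
  obtain ⟨r, hr⟩ : ∃ r, r = heunDisc t x v y ^ (1 / 2 : ℂ) := ⟨_, rfl⟩
  obtain ⟨q, hq⟩ : ∃ q, q = 1 - x * v / t := ⟨_, rfl⟩
  rw [← hr, ← hq] at h hsq ⊢
  have hxv : x * v = t * (1 - q) := by rw [hq]; field_simp; ring
  have hE : discRest t x v y⁻¹ = y * (r ^ 2 - q ^ 2) := by rw [hsq]; field_simp; ring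
  rw [hE, hxv]
  field_simp
  ring

/-- The powers in the kernel are holomorphic for small `x`, `v` and large `y`, uniformly. -/
theorem exists_kernelRegular {t : ℂ} (ht : t ≠ 0) : ∃ δ : ℝ, 0 < δ ∧ ∀ x v y : ℂ,
    ‖x‖ < δ → ‖v‖ < δ → δ⁻¹ < ‖y‖ → KernelRegular t y x v := by
  have ho := Complex.isOpen_slitPlane
  -- `D`, `U₂` and `U₃` are the discriminant and the two bases in the variables `(x, v, 1/y)`. All
  -- three are continuous at the origin with value `1`, so one ball gives uniformity in `y`.
  let D : ℂ × ℂ × ℂ → ℂ := fun q =>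
    (1 - q.1 * q.2.1 / t) ^ 2 + q.2.2 * discRest t q.1 q.2.1 q.2.2
  let R : ℂ × ℂ × ℂ → ℂ := fun q => D q ^ (1 / 2 : ℂ) + (1 - q.1 * q.2.1 / t)
  let U₂ : ℂ × ℂ × ℂ → ℂ := fun q =>
    (2 * t - t * (q.1 + q.2.1) + t * discRest t q.1 q.2.1 q.2.2 / R q)
      / (2 * t * (1 - q.1) * (1 - q.2.1))
  let U₃ : ℂ × ℂ × ℂ → ℂ := fun q =>
    (2 * t ^ 2 - t * (q.1 + q.2.1) + t * discRest t q.1 q.2.1 q.2.2 / R q)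
      / (2 * (t - q.1) * (t - q.2.1))
  have hE : ContinuousAt (fun q : ℂ × ℂ × ℂ => discRest t q.1 q.2.1 q.2.2) 0 := by
    unfold discRest
    fun_prop
  have hE0 : discRest t 0 0 0 = 0 := by simp [discRest]
  have hD : ContinuousAt D 0 := by fun_prop
  have hD0 : D 0 = 1 := by simp [D]
  have hR : ContinuousAt R 0 := by
    refine ContinuousAt.add ?_ (by fun_prop)
    exact hD.cpow continuousAt_const (by simp [hD0])
  have hR0 : R 0 = 2 := by simp [R, hD0]; norm_num
  have hU₂ : ContinuousAt U₂ 0 := by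
    refine ContinuousAt.div (ContinuousAt.add (by fun_prop)
      (ContinuousAt.div (by fun_prop) hR (by simp [hR0]))) (by fun_prop) (by simp [ht])
  have hU₂0 : U₂ 0 = 1 := by simp [U₂, hE0, ht]
  have hU₃ : ContinuousAt U₃ 0 := by
    refine ContinuousAt.div (ContinuousAt.add (by fun_prop)
      (ContinuousAt.div (by fun_prop) hR (by simp [hR0]))) (by fun_prop) (by simp [ht])
  have hU₃0 : U₃ 0 = 1 := by
    simp only [U₃, Prod.fst_zero, Prod.snd_zero, hE0]
    field_simp
    ring
  have hev : ∀ᶠ q in 𝓝 0, D q ∈ Complex.slitPlane ∧ U₂ q ∈ Complex.slitPlane ∧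
      U₃ q ∈ Complex.slitPlane ∧ R q ≠ 0 := (hD.eventually (ho.mem_nhds (by simp [hD0]))).and
    ((hU₂.eventually (ho.mem_nhds (by simp [hU₂0]))).and
    ((hU₃.eventually (ho.mem_nhds (by simp [hU₃0]))).and
    (hR.eventually (isOpen_ne.mem_nhds (show R 0 ≠ 0 by simp [hR0])))))
  obtain ⟨δ, hδ, hball⟩ := Metric.eventually_nhds_iff.mp hev
  refine ⟨δ, hδ, fun x v y hx hv hy => ?_⟩
  have hy0 : 0 < ‖y‖ := (inv_pos.mpr hδ).trans hy
  have hy' : y ≠ 0 := norm_pos_iff.mp hy0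
  have hz : ‖y⁻¹‖ < δ := by
    rw [norm_inv]
    exact inv_lt_of_inv_lt₀ hδ hy
  obtain ⟨k1, k2, k3, k4⟩ := hball (y := (x, v, y⁻¹)) (by
    rw [dist_zero_right]
    exact max_lt hx (max_lt hv hz))
  have hDe : D (x, v, y⁻¹) = heunDisc t x v y := (heunDisc_eq_add_discRest ht hy' x v).symm
  simp only [R, hDe] at k4
  simp only [U₂, R, hDe] at k2
  simp only [U₃, R, hDe] at k3
  have hroot := rationalize_root ht hy' k4
  refine ⟨hDe ▸ k1, ?_, ?_⟩
  · refine Set.mem_of_eq_of_mem ?_ k2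
    rw [heunBase₂, hroot]
    congr 1
    ring
  · refine Set.mem_of_eq_of_mem ?_ k3
    rw [heunBase₃, hroot]
    congr 1
    ring

theorem heunKernel_zero_left {t y : ℂ} (ht : t ≠ 0) (hy : y ≠ 0) (a b : ℂ) :
    ∀ᶠ s in 𝓝 (0 : ℂ), heunKernel t a b y (0, s) = (y - s)⁻¹ := by
  have h1 : ∀ᶠ s in 𝓝 (0 : ℂ), 0 < (1 - s / y).re := by
    have : ContinuousAt (fun s : ℂ => (1 - s / y).re) 0 := by fun_prop
    exact this.eventually (lt_mem_nhds (by simp))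
  have h2 : ∀ᶠ s in 𝓝 (0 : ℂ), 1 - s ≠ 0 := by
    have : ContinuousAt (fun s : ℂ => 1 - s) 0 := by fun_prop
    exact this.eventually_ne (by simp)
  have h3 : ∀ᶠ s in 𝓝 (0 : ℂ), t - s ≠ 0 := by
    have : ContinuousAt (fun s : ℂ => t - s) 0 := by fun_prop
    exact this.eventually_ne (by simpa using ht)
  filter_upwards [h1, h2, h3] with s hs hs1 hst
  have hd : heunDisc t 0 s y = (1 - s / y) ^ 2 := by
    unfold heunDisc
    field_simp
    ring
  -- Positivity of the real part selects this square root as the principal one.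
  have hr : heunDisc t 0 s y ^ (1 / 2 : ℂ) = 1 - s / y := by
    rw [hd, one_div]
    exact Complex.sq_cpow_two_inv hs
  have e2 : heunBase₂ t y 0 s = 1 := by
    rw [heunBase₂, hr]
    field_simp
    ring
  have e3 : heunBase₃ t y 0 s = 1 := by
    rw [heunBase₃, hr]
    field_simp
    ring
  simp only [heunKernel, e2, e3, hr, Complex.one_cpow]
  field_simp

theorem taylorCoeff_heunKernel_zero_left {t y : ℂ} (ht : t ≠ 0) (hy : y ≠ 0) (a b : ℂ) (j : ℕ) :
    taylorCoeff (heunKernel t a b y) 0 j = (y ^ (j + 1))⁻¹ := by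
  have hA := (kernelRegular_zero ht y).analyticAt_heunKernel ht hy a b (p := 0)
  have h1 : mixedDeriv (heunKernel t a b y) 0 j =
      iteratedDeriv j (fun s : ℂ => heunKernel t a b y (s • (0, 1))) 0 :=
    (iteratedDeriv_comp_smul (0, 1) hA j).symm
  have h2 : (fun s : ℂ => heunKernel t a b y (s • (0, 1))) =ᶠ[𝓝 0] fun s => (-1 * s + y)⁻¹ := by
    filter_upwards [heunKernel_zero_left ht hy a b] with s hs
    simp [hs, sub_eq_neg_add]
  rw [taylorCoeff, h1, h2.iteratedDeriv_eq, iteratedDeriv_eq_iterate, iter_deriv_inv_linear]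
  have hfac : (j.factorial : ℂ) ≠ 0 := by exact_mod_cast j.factorial_ne_zero
  have hpow : (y : ℂ) ^ (-1 - j : ℤ) = (y ^ (j + 1))⁻¹ := by
    rw [← zpow_natCast, ← zpow_neg]
    congr 1
    push_cast
    ring
  have hsign : ((-1 : ℂ) ^ j) * (-1) ^ j = 1 := by rw [← mul_pow]; simp
  simp only [mul_zero, zero_add, hpow, Nat.factorial_zero, Nat.cast_one, one_mul]
  rw [div_eq_iff hfac]
  linear_combination (j.factorial * (y ^ (j + 1))⁻¹) * hsign

/-- Both arrays satisfy `HeunRec`, and their rows `i = 0` agree because `P_0 = 1`. -/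
theorem taylorCoeff_heunKernel {t y : ℂ} (ht : t ≠ 0) (hy : y ≠ 0) (a b : ℂ) (i j : ℕ) :
    letI S := heunSequence t 1 (a + 1) (b + 1) 1 (a + b + 1) ht natCast_add_one_ne_zero
    taylorCoeff (heunKernel t a b y) i j = S.resolvent y (S i * S j) := by
  set S := heunSequence t 1 (a + 1) (b + 1) 1 (a + b + 1) ht natCast_add_one_ne_zero
  have hreg := kernelRegular_zero ht y
  refine HeunRec.ext ht (heunRec_taylorCoeff (s₂ := a + 1) (s₃ := b + 1) (r₂ := a + b + 1) (by ring)
    (hreg.analyticAt_heunKernel ht hy a b (p := 0)) ?_)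
    (heunRec_map_mul ht (S.resolvent y)) (fun j => ?_) i j
  · filter_upwards [KernelRegular.eventually ht hy (p := 0) hreg] with p hp
    exact hp.heunPart_fst_eq_snd ht hy a b
  · have h0 : heunPoly t 1 (a + 1) (b + 1) 1 (a + b + 1) 0 = 1 := by simp [heunPoly]
    rw [taylorCoeff_heunKernel_zero_left ht hy, h0, one_mul]
    exact (S.resolvent_apply_self y j).symm

end KernelTheorem

end

theorem theorem5p3p4 (t s₂ s₃ r₂ : ℂ) (ht0 : t ≠ 0) (ht1 : t ≠ 1)
    (hr : 1 + r₂ = 1 + s₂ + s₃ - 1) :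
    ∃ ε : ℝ, 0 < ε ∧ ∀ x₁ x₂ y : ℂ, ‖x₁‖ < ε → ‖x₂‖ < ε → ε⁻¹ < ‖y‖ →
      HasKernel (heunSequence t 1 s₂ s₃ 1 r₂ ht0 natCast_add_one_ne_zero) x₁ x₂ y
        (((2 * t - t * (x₁ + x₂ + y) + x₁ * x₂ * y + t * y * heunDisc t x₁ x₂ y ^ (1 / 2 : ℂ))
              / (2 * t * (1 - x₁) * (1 - x₂))) ^ (s₂ - 1)
          * ((2 * t ^ 2 - t * (x₁ + x₂ + y) + x₁ * x₂ * y
                + t * y * heunDisc t x₁ x₂ y ^ (1 / 2 : ℂ))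
              / (2 * (t - x₁) * (t - x₂))) ^ (s₃ - 1)
          * (1 / (y * heunDisc t x₁ x₂ y ^ (1 / 2 : ℂ)))) := by
  obtain ⟨a, rfl⟩ : ∃ a, s₂ = a + 1 := ⟨s₂ - 1, by ring⟩
  obtain ⟨b, rfl⟩ : ∃ b, s₃ = b + 1 := ⟨s₃ - 1, by ring⟩
  obtain rfl : r₂ = a + b + 1 := by linear_combination hr
  obtain ⟨ε₁, hε₁, hsum⟩ := summable_kernel (s₂ := a + 1) (s₃ := b + 1) (r₂ := a + b + 1) ht0
  obtain ⟨δ, hδ, hreg⟩ := exists_kernelRegular ht0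
  -- `δ / 2` keeps `(s x₁, s x₂)` in the regular region for all `‖s‖ < 2`, as `hasSum_taylorCoeff`
  -- requires; the bound `1` ensures `1 ≤ ‖y‖` for `summable_kernel`.
  refine ⟨min (min ε₁ (δ / 2)) 1, by positivity, fun x₁ x₂ y hx₁ hx₂ hy => ?_⟩
  obtain ⟨⟨hx₁ε, hx₁δ⟩, -⟩ := lt_min_iff.mp hx₁ |>.imp_left lt_min_iff.mp
  obtain ⟨⟨hx₂ε, hx₂δ⟩, -⟩ := lt_min_iff.mp hx₂ |>.imp_left lt_min_iff.mp
  have hpos : 0 < min (min ε₁ (δ / 2)) 1 := by positivity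
  have hy1 : 1 ≤ ‖y‖ :=
    ((one_le_inv₀ hpos).mpr (min_le_right _ _)).trans hy.le
  have hyδ : δ⁻¹ < ‖y‖ := by
    refine lt_of_le_of_lt (inv_anti₀ hpos ?_) hy
    exact (min_le_left _ _).trans ((min_le_right _ _).trans (by linarith))
  have hy0 : y ≠ 0 := norm_pos_iff.mp (by linarith)
  refine hasKernel_of_hasSum (hsum x₁ x₂ y hx₁ε hx₂ε hy1) ?_
  have hA := (kernelRegular_zero ht0 y).analyticAt_heunKernel ht0 hy0 a b (p := 0)
  have key := hasSum_taylorCoeff hA (x₁ := x₁) (x₂ := x₂) fun s hs => ?_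
  · simp only [taylorCoeff_heunKernel ht0 hy0] at key
    simpa only [heunKernel, heunBase₂, heunBase₃, add_sub_cancel_right] using key
  · refine ((hreg (s * x₁) (s * x₂) y ?_ ?_ hyδ).analyticAt_heunKernel ht0 hy0 a b
      (p := (s * x₁, s * x₂))).differentiableAt
    all_goals
      rw [norm_mul]
      nlinarith [norm_nonneg s, norm_nonneg x₁, norm_nonneg x₂]
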